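/- Let $K$ be a field of arbitrary characteristic, $n\ge 0$, $R=K[x_1,\dots,x_n]$ with its standard grading, $\mathfrak m=(x_1,\dots,x_n)$, and let $\mathscr D=R\langle\partial_i^{[j]}\mid 1\le i\le n,\ j\ge 1\rangle\subseteq\operatorname{End}_K(R)$ be the ring of differential operators of $R$, where $\partial_i^{[j]}=\frac1{j!}\frac{\partial^j}{\partial x_i^j}$ is the divided power operator $x_i^a\mapsto\binom aj x_i^{a-j}$. The ring $\mathscr D$ is graded by $\deg x_i=1$, $\deg\partial_i^{[j]}=-j$, $\deg c=0$ for $c\in K$. A graded $\mathscr D$-module is a left $\mathscr D$-module with a compatible $\mathbb Z$-grading, and $M(\ell)_j=M_{\ell+j}$. For a graded $\mathscr D$-module $M$ and a homogeneous ideal $J=(f_1,\dots,f_l)$ with $f_1,\dots,f_l$ homogeneous, $H^i_J(M)$ denotes the $i$-th cohomology of the Čech complex $$0\to M\to\bigoplus_j M_{f_j}\to\bigoplus_{j<k}M_{f_jf_k}\to\cdots\to M_{f_1\cdots f_l}\to 0,$$ which is a complex of graded $\mathscr D$-modules, so that $H^i_J(M)$ is a graded $\mathscr D$-module. Let ${}^*E$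 be the graded injective hull of $R/\mathfrak m$, realized with its $\mathscr D$-module structure as the module of inverse polynomials $R_{x_1\cdots x_n}/\sum_{i}R_{x_1\cdots\widehat{x_i}\cdots x_n}$ (with $K$-basis the classes of the monomials $x_1^{j_1}\cdots x_n^{j_n}$ with all $j_t\le -1$), graded so that the class of $\frac1{x_1\cdots x_n}$ has degree $0$. **Theorem.** Let $s\ge 0$, let $J_1,\dots,J_s$ be homogeneous ideals of $R$ and let $i_0,i_1,\dots,i_s\ge 0$. Put $$H=H^{i_0}_{\mathfrak m}\bigl(H^{i_1}_{J_1}(\cdots(H^{i_s}_{J_s}(R)))\bigr),$$ computed with any finite systems of homogeneous generators of $\mathfrak m,J_1,\dots,J_s$. Then $H$ is isomorphic, as a graded $\mathscr D$-module, to a direct sum of copies of ${}^*E(n)$. Moreover, all socle elements of $H$ have degree $-n$, that is, every $z\in H$ with $\mathfrak m z=0$ lies in $H_{-n}$. -/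

import Mathlib

universe u

namespace GradedD

open MvPolynomial

section Operators

variable (K : Type u) [Field K] (n : ℕ)

/-- The divided power operator `∂ᵢ^[j] = (1 / j!) ∂ʲ / ∂xᵢʲ` on `K[x₁, …, xₙ]`: it maps the monomial
`xᵐ` to `(mᵢ choose j) xᵐ⁻ʲ` (exponent of `xᵢ` lowered by `j`), in every characteristic. -/
noncomputable def partialDeriv (i : Fin n) (j : ℕ) :
    Module.End K (MvPolynomial (Fin n) K) :=
  (basisMonomials (Fin n) K).constr K fun m =>
    monomial (m - Finsupp.single i j) ((m i).choose j : K)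

/-- The ring of differential operators `R⟨∂ᵢ^[j]⟩` of `R = K[x₁, …, xₙ]`, as the subalgebra of
`End_K(R)` generated by the multiplications by the variables and the operators `∂ᵢ^[j]`. -/
noncomputable def diffOpAlgebra : Subalgebra K (Module.End K (MvPolynomial (Fin n) K)) :=
  Algebra.adjoin K
    ({P | ∃ i : Fin n, P = LinearMap.mulLeft K (X i)} ∪
      {P | ∃ (i : Fin n) (j : ℕ), 1 ≤ j ∧ P = partialDeriv K n i j})

/-- The ring `𝒟` of differential operators. -/
def DiffOp : Type u := ↥(diffOpAlgebra K n)

noncomputable instance : Ring (DiffOp K n) :=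
  inferInstanceAs (Ring (diffOpAlgebra K n))

noncomputable instance : Algebra K (DiffOp K n) :=
  inferInstanceAs (Algebra K (diffOpAlgebra K n))

/-- The inclusion of `𝒟` into `End_K(R)`. -/
noncomputable def DiffOp.toEnd : DiffOp K n →ₐ[K] Module.End K (MvPolynomial (Fin n) K) :=
  (diffOpAlgebra K n).val

/-- `R` is a `𝒟`-module: operators act on polynomials. -/
noncomputable instance : Module (DiffOp K n) (MvPolynomial (Fin n) K) :=
  inferInstanceAs (Module (diffOpAlgebra K n) (MvPolynomial (Fin n) K))

instance : IsScalarTower K (DiffOp K n) (MvPolynomial (Fin n) K) :=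
  inferInstanceAs (IsScalarTower K (diffOpAlgebra K n) (MvPolynomial (Fin n) K))

variable {K n}

theorem partialDeriv_monomial (i : Fin n) (j : ℕ) (m : Fin n →₀ ℕ) (c : K) :
    partialDeriv K n i j (monomial m c) =
      monomial (m - Finsupp.single i j) (c * ((m i).choose j : K)) := by
  have h : monomial m c = c • (basisMonomials (Fin n) K) m := by
    simp [coe_basisMonomials, smul_monomial]
  rw [h, map_smul, partialDeriv, Module.Basis.constr_basis, smul_monomial, smul_eq_mul]

theorem partialDeriv_zero (i : Fin n) : partialDeriv K n i 0 = 1 := by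
  refine (basisMonomials (Fin n) K).ext fun m => ?_
  simp [coe_basisMonomials, partialDeriv_monomial]

/-- The Leibniz rule for divided power operators. -/
theorem partialDeriv_mul (i : Fin n) (j : ℕ) (f g : MvPolynomial (Fin n) K) :
    partialDeriv K n i j (f * g) =
      ∑ p ∈ Finset.HasAntidiagonal.antidiagonal j, partialDeriv K n i p.1 f * partialDeriv K n i p.2 g := by
  induction f using MvPolynomial.induction_on' with
  | add p q hp hq => simp only [add_mul, map_add, hp, hq, Finset.sum_add_distrib]
  | monomial a c =>
    induction g using MvPolynomial.induction_on' with
    | add p q hp hq => simp only [mul_add, map_add, hp, hq, Finset.sum_add_distrib]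
    | monomial b d =>
      simp only [monomial_mul, partialDeriv_monomial]
      have key : ∀ p ∈ Finset.HasAntidiagonal.antidiagonal j,
          monomial (a - Finsupp.single i p.1 + (b - Finsupp.single i p.2))
            (c * ((a i).choose p.1 : K) * (d * ((b i).choose p.2 : K))) =
          monomial (a + b - Finsupp.single i j)
            (c * d * (((a i).choose p.1 * (b i).choose p.2 : ℕ) : K)) := by
        intro p hp
        rw [Finset.HasAntidiagonal.mem_antidiagonal] at hp
        rcases lt_or_ge (a i) p.1 with h1 | h1
        · simp [Nat.choose_eq_zero_of_lt h1]
        rcases lt_or_ge (b i) p.2 with h2 | h2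
        · simp [Nat.choose_eq_zero_of_lt h2]
        have e : a - Finsupp.single i p.1 + (b - Finsupp.single i p.2) =
            a + b - Finsupp.single i j := by
          ext k
          by_cases hk : i = k
          · subst hk
            simp
            omega
          · simp [hk]
        rw [e]
        congr 1
        push_cast
        ring
      rw [Finset.sum_congr rfl key, ← map_sum, ← Finset.mul_sum, ← Nat.cast_sum,
        ← Nat.add_choose_eq, Finsupp.add_apply]

theorem mulLeft_mem (f : MvPolynomial (Fin n) K) :
    Algebra.lmul K (MvPolynomial (Fin n) K) f ∈ diffOpAlgebra K n := by
  induction f using MvPolynomial.induction_on with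
  | C a =>
    rw [← algebraMap_eq, AlgHom.commutes]
    exact (diffOpAlgebra K n).algebraMap_mem a
  | add p q hp hq => rw [map_add]; exact add_mem hp hq
  | mul_X p i hp =>
    rw [map_mul]
    exact mul_mem hp (Algebra.subset_adjoin (Or.inl ⟨i, rfl⟩))

/-- The inclusion of `R` into `𝒟`: a polynomial acts by multiplication. -/
noncomputable def mulOp : MvPolynomial (Fin n) K →ₐ[K] DiffOp K n :=
  (Algebra.lmul K (MvPolynomial (Fin n) K)).codRestrict (diffOpAlgebra K n) mulLeft_mem

theorem partialDeriv_mem (i : Fin n) (j : ℕ) : partialDeriv K n i j ∈ diffOpAlgebra K n := by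
  rcases Nat.eq_zero_or_pos j with rfl | h
  · rw [partialDeriv_zero]; exact one_mem _
  · exact Algebra.subset_adjoin (Or.inr ⟨i, j, h, rfl⟩)

/-- The operator `∂ᵢ^[j]` as an element of `𝒟`. -/
noncomputable def partialOp (i : Fin n) (j : ℕ) : DiffOp K n :=
  ⟨partialDeriv K n i j, partialDeriv_mem i j⟩

/-- `IsHomogeneousOp d P` says that `P ∈ 𝒟` is homogeneous of degree `d` for the natural grading
of `𝒟`, which is the one with `deg c = 0` for `c ∈ K`, `deg xᵢ = 1` and `deg ∂ᵢ^[j] = -j`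
(and `0` is homogeneous of every degree). -/
inductive IsHomogeneousOp : ℤ → DiffOp K n → Prop
  | zero (d : ℤ) : IsHomogeneousOp d 0
  | const (c : K) : IsHomogeneousOp 0 (algebraMap K (DiffOp K n) c)
  | var (i : Fin n) : IsHomogeneousOp 1 (mulOp (X i))
  | deriv (i : Fin n) (j : ℕ) : IsHomogeneousOp (-(j : ℤ)) (partialOp i j)
  | add {d : ℤ} {P Q : DiffOp K n} :
      IsHomogeneousOp d P → IsHomogeneousOp d Q → IsHomogeneousOp d (P + Q)
  | mul {d e : ℤ} {P Q : DiffOp K n} :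
      IsHomogeneousOp d P → IsHomogeneousOp e Q → IsHomogeneousOp (d + e) (P * Q)

theorem diffOp_induction {p : DiffOp K n → Prop}
    (hc : ∀ c : K, p (algebraMap K (DiffOp K n) c)) (hX : ∀ i, p (mulOp (X i)))
    (hd : ∀ i j, p (partialOp i j)) (hadd : ∀ P Q, p P → p Q → p (P + Q))
    (hmul : ∀ P Q, p P → p Q → p (P * Q)) (P : DiffOp K n) : p P := by
  obtain ⟨P, hP⟩ := P
  induction hP using Algebra.adjoin_induction with
  | mem x hx =>
    rcases hx with ⟨i, rfl⟩ | ⟨i, j, _, rfl⟩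
    · exact hX i
    · exact hd i j
  | algebraMap r => exact hc r
  | add x y hx hy h1 h2 => exact hadd _ _ h1 h2
  | mul x y hx hy h1 h2 => exact hmul _ _ h1 h2

theorem DiffOp.toEnd_injective : Function.Injective (DiffOp.toEnd K n) :=
  Subtype.val_injective

theorem partialOp_mul_mulOp (i : Fin n) (j : ℕ) (f : MvPolynomial (Fin n) K) :
    partialOp i j * mulOp f = ∑ p ∈ Finset.HasAntidiagonal.antidiagonal j,
      mulOp (partialDeriv K n i p.1 f) * partialOp i p.2 := by
  apply DiffOp.toEnd_injective
  rw [map_sum]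
  apply LinearMap.ext
  intro g
  rw [LinearMap.sum_apply]
  exact partialDeriv_mul i j f g

end Operators

section Ore

variable {A : Type u} [Ring A]

/-- The commutator with a fixed element. -/
def adj (F P : A) : A := F * P - P * F

theorem adj_iterate_zero (F : A) (k : ℕ) : (adj F)^[k] 0 = 0 :=
  Function.iterate_fixed (by simp [adj]) k

theorem adj_iterate_add (F : A) (k : ℕ) (P Q : A) :
    (adj F)^[k] (P + Q) = (adj F)^[k] P + (adj F)^[k] Q := by
  induction k generalizing P Q with
  | zero => rfl
  | succ k ih =>
    simp only [Function.iterate_succ_apply, ← ih]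
    congr 1
    simp only [adj]
    noncomm_ring

theorem adj_iterate_mono {F P : A} {k l : ℕ} (hkl : k ≤ l) (h : (adj F)^[k] P = 0) :
    (adj F)^[l] P = 0 := by
  obtain ⟨m, rfl⟩ := Nat.exists_eq_add_of_le' hkl
  rw [Function.iterate_add_apply, h, adj_iterate_zero]

theorem adj_iterate_mul {F : A} (N a b : ℕ) (hN : a + b = N) (P Q : A)
    (hP : (adj F)^[a] P = 0) (hQ : (adj F)^[b] Q = 0) : (adj F)^[N] (P * Q) = 0 := by
  induction N generalizing a b P Q with
  | zero =>
    obtain rfl : a = 0 := by omega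
    simp only [Function.iterate_zero, id] at hP ⊢
    simp [hP]
  | succ N ih =>
    rcases a with _ | a
    · simp only [Function.iterate_zero, id] at hP
      rw [hP, zero_mul, adj_iterate_zero]
    rcases b with _ | b
    · simp only [Function.iterate_zero, id] at hQ
      rw [hQ, mul_zero, adj_iterate_zero]
    rw [Function.iterate_succ_apply,
      show adj F (P * Q) = adj F P * Q + P * adj F Q by simp only [adj]; noncomm_ring,
      adj_iterate_add, ih a (b + 1) (by omega) (adj F P) Q hP hQ,
      ih (a + 1) b (by omega) P (adj F Q) hP hQ, add_zero]

/-- If commutation with `F` is locally nilpotent, the powers of `F` form a (left) Ore set. -/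
theorem nonempty_oreSet_powers (F : A) (h : ∀ P : A, ∃ k, (adj F)^[k] P = 0) :
    Nonempty (OreLocalization.OreSet (Submonoid.powers F)) := by
  have one : ∀ (k : ℕ) (P : A), (adj F)^[k] P = 0 → ∃ N P', F ^ N * P = P' * F := by
    intro k
    induction k with
    | zero => intro P hP; exact ⟨0, 0, by simpa using hP⟩
    | succ k ih =>
      intro P hP
      obtain ⟨N, Q, hQ⟩ := ih (adj F P) hP
      refine ⟨N + 1, F ^ N * P + Q, ?_⟩
      rw [add_mul, ← hQ, adj, pow_succ]
      noncomm_ring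
  have all : ∀ (t : ℕ) (P : A), ∃ N P', F ^ N * P = P' * F ^ t := by
    intro t
    induction t with
    | zero => intro P; exact ⟨0, P, by simp⟩
    | succ t ih =>
      intro P
      obtain ⟨k, hk⟩ := h P
      obtain ⟨N, Q, hQ⟩ := one k P hk
      obtain ⟨M, Q', hQ'⟩ := ih Q
      refine ⟨M + N, Q', ?_⟩
      rw [pow_add, mul_assoc, hQ, ← mul_assoc, hQ', mul_assoc, ← pow_succ]
  have canc : ∀ (t k : ℕ) (P : A), (adj F)^[k] P = 0 → P * F ^ t = 0 → ∃ N, F ^ N * P = 0 := by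
    intro t k
    induction k with
    | zero => intro P hP _; exact ⟨0, by simpa using hP⟩
    | succ k ih =>
      intro P hP h0
      have h1 : adj F P * F ^ t = 0 := by
        rw [adj, sub_mul, mul_assoc, h0, mul_assoc, ← pow_succ', pow_succ, ← mul_assoc P, h0]
        simp
      obtain ⟨N, hN⟩ := ih _ hP h1
      have h2 : F ^ N * (F * P) = F ^ N * P * F := by
        rw [adj, mul_sub, sub_eq_zero] at hN
        rw [hN, mul_assoc]
      have h3 : ∀ m, F ^ (m + N) * P = F ^ N * P * F ^ m := by
        intro m
        induction m with
        | zero => simp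
        | succ m ihm =>
          calc F ^ (m + 1 + N) * P = F ^ m * (F ^ N * (F * P)) := by
                rw [show m + 1 + N = m + N + 1 by omega, pow_succ, pow_add]; noncomm_ring
            _ = F ^ (m + N) * P * F := by rw [h2, pow_add]; noncomm_ring
            _ = _ := by rw [ihm, mul_assoc, ← pow_succ]
      exact ⟨t + N, by rw [h3, mul_assoc, h0, mul_zero]⟩
  rw [OreLocalization.nonempty_oreSet_iff]
  constructor
  · rintro r₁ r₂ ⟨_, t, rfl⟩ hr
    obtain ⟨k, hk⟩ := h (r₁ - r₂)
    obtain ⟨N, hN⟩ := canc t k _ hk (by rw [sub_mul, sub_eq_zero]; exact hr)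
    exact ⟨⟨F ^ N, N, rfl⟩, by rwa [mul_sub, sub_eq_zero] at hN⟩
  · rintro r ⟨_, t, rfl⟩
    obtain ⟨N, P', hP'⟩ := all t r
    exact ⟨P', ⟨F ^ N, N, rfl⟩, hP'⟩

variable {K : Type u} [Field K] {n : ℕ}

theorem adj_locally_nilpotent (f : MvPolynomial (Fin n) K) (P : DiffOp K n) :
    ∃ k, (adj (mulOp f))^[k] P = 0 := by
  have hR : ∀ g : MvPolynomial (Fin n) K, (adj (mulOp f))^[1] (mulOp g) = 0 := by
    intro g
    simp only [Function.iterate_one, adj]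
    rw [← map_mul, ← map_mul, mul_comm, sub_self]
  induction P using diffOp_induction with
  | hc c => exact ⟨1, by rw [← mulOp.commutes]; exact hR _⟩
  | hX i => exact ⟨1, hR _⟩
  | hd i j =>
    induction j using Nat.strong_induction_on with
    | _ j ih =>
      have h1 : ∀ s : Finset (ℕ × ℕ), (∀ p ∈ s, p.2 < j) →
          ∃ k, (adj (mulOp f))^[k] (∑ p ∈ s,
            mulOp (partialDeriv K n i p.1 f) * partialOp i p.2) = 0 := by
        intro s
        induction s using Finset.induction_on with
        | empty => intro _; exact ⟨0, rfl⟩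
        | insert p s hp ihs =>
          intro hs
          obtain ⟨k, hk⟩ := ihs fun q hq => hs q (Finset.mem_insert_of_mem hq)
          obtain ⟨l, hl⟩ := ih p.2 (hs p (Finset.mem_insert_self _ _))
          refine ⟨max (1 + l) k, ?_⟩
          rw [Finset.sum_insert hp, adj_iterate_add,
            adj_iterate_mono (le_max_left _ _) (adj_iterate_mul _ 1 l rfl _ _ (hR _) hl),
            adj_iterate_mono (le_max_right _ _) hk, add_zero]
      obtain ⟨k, hk⟩ := h1 ((Finset.HasAntidiagonal.antidiagonal j).erase (0, j)) (by
        rintro ⟨a, b⟩ hp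
        simp only [Finset.mem_erase, Finset.HasAntidiagonal.mem_antidiagonal, ne_eq, Prod.mk.injEq] at hp
        simp only
        omega)
      have h2 := partialOp_mul_mulOp i j f
      rw [← Finset.add_sum_erase _ _
        (show ((0, j) : ℕ × ℕ) ∈ Finset.HasAntidiagonal.antidiagonal j by simp)] at h2
      simp only [partialDeriv_zero, Module.End.one_apply] at h2
      refine ⟨k + 1 + 1, ?_⟩
      have h3 : (adj (mulOp f) (partialOp i j) : DiffOp K n) + ∑ p ∈ (Finset.HasAntidiagonal.antidiagonal j).erase (0, j),
          mulOp (partialDeriv K n i p.1 f) * partialOp i p.2 = 0 := by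
        rw [adj, h2]; abel
      have h4 := congrArg (adj (mulOp f))^[k + 1] h3
      rw [adj_iterate_add, adj_iterate_mono (Nat.le_succ k) hk, add_zero, adj_iterate_zero] at h4
      exact h4
  | hadd P Q hP hQ =>
    obtain ⟨k, hk⟩ := hP
    obtain ⟨l, hl⟩ := hQ
    exact ⟨max k l, by rw [adj_iterate_add, adj_iterate_mono (le_max_left _ _) hk,
      adj_iterate_mono (le_max_right _ _) hl, add_zero]⟩
  | hmul P Q hP hQ =>
    obtain ⟨k, hk⟩ := hP
    obtain ⟨l, hl⟩ := hQ
    exact ⟨k + l, adj_iterate_mul _ k l rfl P Q hk hl⟩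

/-- The powers of a polynomial form an Ore set in `𝒟`, so that every `𝒟`-module can be localized
at it. -/
noncomputable instance oreSetPowers (f : MvPolynomial (Fin n) K) :
    OreLocalization.OreSet (Submonoid.powers (mulOp f : DiffOp K n)) :=
  (nonempty_oreSet_powers _ (adj_locally_nilpotent f)).some

end Ore

section Grading

variable {M : Type*} [AddCommGroup M]

theorem isInternal_of_iSup (A : ℤ → AddSubgroup M) (h₁ : ∀ m : M, m ∈ ⨆ j, A j)
    (h₂ : ∀ (s : Finset ℤ) (c : ℤ → M), (∀ j, c j ∈ A j) → ∑ j ∈ s, c j = 0 →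
      ∀ j ∈ s, c j = 0) :
    DirectSum.IsInternal A := by
  classical
  constructor
  · rw [injective_iff_map_eq_zero]
    intro x hx
    rw [DirectSum.coeAddMonoidHom_eq_dfinsuppSum] at hx
    have h := h₂ x.support (fun j => (x j : M)) (fun j => (x j).2) hx
    ext j
    by_cases hj : j ∈ x.support
    · exact h j hj
    · rw [DFinsupp.notMem_support_iff] at hj
      exact congrArg Subtype.val hj
  · intro m
    have hle : (⨆ j, A j) ≤ (DirectSum.coeAddMonoidHom A).range := by
      refine iSup_le fun j a ha => ⟨DirectSum.of (fun j => A j) j ⟨a, ha⟩, ?_⟩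
      rw [DirectSum.coeAddMonoidHom_of]
    exact hle (h₁ m)

theorem mem_iSup_of_isInternal {A : ℤ → AddSubgroup M} (h : DirectSum.IsInternal A) (m : M) :
    m ∈ ⨆ j, A j := by
  classical
  obtain ⟨x, rfl⟩ := h.2 m
  rw [DirectSum.coeAddMonoidHom_eq_dfinsuppSum]
  exact sum_mem fun j _ => AddSubgroup.mem_iSup_of_mem j (x j).2

/-- A finite sum of homogeneous elements of distinct degrees vanishes only if all its terms do. -/
theorem eq_zero_of_isInternal {A : ℤ → AddSubgroup M} (h : DirectSum.IsInternal A) (d : ℤ)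
    (s : Finset ℤ) (c : ℤ → M) (hc : ∀ j ∈ s, c j ∈ A (j + d)) (h0 : ∑ j ∈ s, c j = 0) :
    ∀ j ∈ s, c j = 0 := by
  classical
  have h1 : (∑ j ∈ s.attach, DirectSum.of (fun j => A j) (j + d) ⟨c j, hc j j.2⟩) = 0 := by
    apply h.1
    rw [map_sum, map_zero]
    simp only [DirectSum.coeAddMonoidHom_of]
    rw [← h0, ← Finset.sum_attach s]
  intro j hj
  have h2 := DFunLike.congr_fun h1 (j + d)
  rw [DFinsupp.finsetSum_apply, Finset.sum_eq_single (⟨j, hj⟩ : s)] at h2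
  · rw [DirectSum.of_eq_same] at h2
    exact congrArg Subtype.val h2
  · intro b _ hb
    refine DirectSum.of_eq_of_ne _ _ _ fun h => hb (Subtype.ext ?_)
    simpa using h.symm
  · exact fun h => absurd (Finset.mem_attach _ _) h

theorem iSup_induction_deg {A : ℤ → AddSubgroup M} {p : ∀ x : M, (x ∈ ⨆ j, A j) → Prop}
    (mem : ∀ j x (hx : x ∈ A j), p x (AddSubgroup.mem_iSup_of_mem j hx)) (zero : p 0 (zero_mem _))
    (add : ∀ x y hx hy, p x hx → p y hy → p (x + y) (add_mem hx hy)) {x : M}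
    (hx : x ∈ ⨆ j, A j) : p x hx :=
  AddSubgroup.iSup_induction' A mem zero add hx

theorem exists_sum_of_mem_iSup {A : ℤ → AddSubgroup M} {m : M} (h : m ∈ ⨆ j, A j) :
    ∃ (s : Finset ℤ) (c : ℤ → M), (∀ j, c j ∈ A j) ∧ (∀ j ∉ s, c j = 0) ∧ ∑ j ∈ s, c j = m := by
  classical
  induction h using iSup_induction_deg with
  | mem i x hx =>
    refine ⟨{i}, Pi.single i x, fun j => ?_, fun j hj => ?_, by simp⟩
    · by_cases hj : j = i
      · subst hj; simpa using hx
      · rw [Pi.single_eq_of_ne hj]; exact zero_mem _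
    · exact Pi.single_eq_of_ne (by simpa using hj) _
  | zero => exact ⟨∅, 0, fun j => zero_mem _, fun _ _ => rfl, rfl⟩
  | add x y _ _ hx hy =>
    obtain ⟨s, c, h1, h2, rfl⟩ := hx
    obtain ⟨t, d, h3, h4, rfl⟩ := hy
    refine ⟨s ∪ t, c + d, fun j => add_mem (h1 j) (h3 j), fun j hj => ?_, ?_⟩
    · rw [Finset.mem_union, not_or] at hj
      simp [h2 j hj.1, h4 j hj.2]
    · simp only [Pi.add_apply, Finset.sum_add_distrib]
      rw [Finset.sum_subset Finset.subset_union_left fun j _ hj => h2 j hj,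
        Finset.sum_subset Finset.subset_union_right fun j _ hj => h4 j hj]

end Grading

/-- A graded `𝒟`-module: a left `𝒟`-module with a `ℤ`-grading `M = ⨁ⱼ Mⱼ` that is compatible with
the natural grading of `𝒟`. -/
structure GradedDModule (K : Type u) [Field K] (n : ℕ) where
  /-- the underlying set -/
  carrier : Type u
  [addCommGroup : AddCommGroup carrier]
  [module : Module (DiffOp K n) carrier]
  /-- the homogeneous elements of degree `j` (and `0`) -/
  deg : ℤ → AddSubgroup carrier
  isInternal : DirectSum.IsInternal deg
  smul_mem : ∀ {k j : ℤ} {P : DiffOp K n} {z : carrier},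
    IsHomogeneousOp k P → z ∈ deg j → P • z ∈ deg (k + j)

attribute [instance] GradedDModule.addCommGroup GradedDModule.module

section Constructions

variable {K : Type u} [Field K] {n : ℕ}

/-- Compatibility of a grading with that of `𝒟` may be tested on the generators of `𝒟`. -/
theorem smul_mem_of_generators {M : Type*} [AddCommGroup M] [Module (DiffOp K n) M]
    {A : ℤ → AddSubgroup M}
    (hc : ∀ (c : K) (j : ℤ) (z : M), z ∈ A j → algebraMap K (DiffOp K n) c • z ∈ A j)
    (hX : ∀ (i : Fin n) (j : ℤ) (z : M), z ∈ A j → (mulOp (X i) : DiffOp K n) • z ∈ A (1 + j))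
    (hd : ∀ (i : Fin n) (a : ℕ) (j : ℤ) (z : M), z ∈ A j →
      (partialOp i a : DiffOp K n) • z ∈ A (-(a : ℤ) + j))
    {k j : ℤ} {P : DiffOp K n} {z : M} (hP : IsHomogeneousOp k P) (hz : z ∈ A j) :
    P • z ∈ A (k + j) := by
  induction hP generalizing j z with
  | zero => rw [zero_smul]; exact zero_mem _
  | const c => rw [zero_add]; exact hc c j z hz
  | var i => exact hX i j z hz
  | deriv i a => exact hd i a j z hz
  | add _ _ h1 h2 => rw [add_smul]; exact add_mem (h1 hz) (h2 hz)
  | mul _ _ h1 h2 => rw [mul_smul, add_assoc]; exact h1 (h2 hz)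

/-- The homogeneous polynomials of degree `j ∈ ℤ` (only `0` if `j < 0`). -/
noncomputable def polyDeg (K : Type u) [Field K] (n : ℕ) (j : ℤ) :
    AddSubgroup (MvPolynomial (Fin n) K) where
  carrier := {g | ∀ m ∈ g.support, (m.degree : ℤ) = j}
  zero_mem' := by simp
  add_mem' := by
    intro a b ha hb m hm
    classical
    rcases Finset.mem_union.1 (support_add hm) with h | h
    · exact ha m h
    · exact hb m h
  neg_mem' := by
    intro a ha m hm
    rw [support_neg] at hm
    exact ha m hm

theorem mem_polyDeg {j : ℤ} {g : MvPolynomial (Fin n) K} :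
    g ∈ polyDeg K n j ↔ ∀ m ∈ g.support, (m.degree : ℤ) = j := Iff.rfl

theorem monomial_mem_polyDeg {j : ℤ} {m : Fin n →₀ ℕ} (h : (m.degree : ℤ) = j) (c : K) :
    monomial m c ∈ polyDeg K n j := by
  intro m' hm'
  rw [Finset.mem_singleton.1 (support_monomial_subset hm'), h]

theorem mem_polyDeg_of_isHomogeneous {f : MvPolynomial (Fin n) K} {e : ℕ}
    (hf : f.IsHomogeneous e) : f ∈ polyDeg K n e := by
  intro m hm
  have := hf (mem_support_iff.1 hm)
  rw [Finsupp.degree_eq_weight_one]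
  exact_mod_cast this

theorem polyDeg_induction {j : ℤ} (p : MvPolynomial (Fin n) K → Prop) (h0 : p 0)
    (hm : ∀ (m : Fin n →₀ ℕ) (c : K), (m.degree : ℤ) = j → p (monomial m c))
    (ha : ∀ f g, p f → p g → p (f + g)) {g : MvPolynomial (Fin n) K} (hg : g ∈ polyDeg K n j) :
    p g := by
  rw [g.as_sum]
  exact Finset.sum_induction _ p ha h0 fun m hmem => hm m _ (hg m hmem)

theorem mul_mem_polyDeg {j k : ℤ} {f g : MvPolynomial (Fin n) K} (hf : f ∈ polyDeg K n j)
    (hg : g ∈ polyDeg K n k) : f * g ∈ polyDeg K n (j + k) := by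
  intro m hm
  classical
  obtain ⟨a, ha, b, hb, rfl⟩ := Finset.mem_add.1 (support_mul _ _ hm)
  rw [map_add, Nat.cast_add, hf a ha, hg b hb]

theorem partialDeriv_mem_polyDeg (i : Fin n) (a : ℕ) {j : ℤ} {g : MvPolynomial (Fin n) K}
    (hg : g ∈ polyDeg K n j) : partialDeriv K n i a g ∈ polyDeg K n (-(a : ℤ) + j) := by
  refine polyDeg_induction (fun g => partialDeriv K n i a g ∈ polyDeg K n (-(a : ℤ) + j)) ?_ ?_ ?_ hg
  · rw [map_zero]; exact zero_mem _
  · intro m c h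
    rw [partialDeriv_monomial]
    rcases lt_or_ge (m i) a with h1 | h1
    · simp [Nat.choose_eq_zero_of_lt h1]
    · refine monomial_mem_polyDeg ?_ _
      have h2 : m = (m - Finsupp.single i a) + Finsupp.single i a := by
        rw [tsub_add_cancel_of_le]
        simpa using h1
      have h3 := congrArg Finsupp.degree h2
      rw [map_add, Finsupp.degree_single] at h3
      omega
  · intro f g hf hg
    rw [map_add]; exact add_mem hf hg

theorem isHomogeneousOp_mulOp {j : ℤ} {g : MvPolynomial (Fin n) K} (hg : g ∈ polyDeg K n j) :
    IsHomogeneousOp j (mulOp g : DiffOp K n) := by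
  refine polyDeg_induction (fun g => IsHomogeneousOp j (mulOp g : DiffOp K n)) ?_ ?_ ?_ hg
  · rw [map_zero]; exact .zero j
  · intro m c h
    clear hg
    induction m using Finsupp.induction_linear generalizing j c with
    | zero =>
      obtain rfl : j = 0 := by simpa using h.symm
      have : (mulOp (monomial 0 c) : DiffOp K n) = algebraMap K _ c := mulOp.commutes c
      rw [this]
      exact .const c
    | add a b iha ihb =>
      rw [map_add, Nat.cast_add] at h
      rw [← one_mul c, ← monomial_mul, map_mul, ← h]
      exact .mul (iha 1 rfl) (ihb c rfl)
    | single i a =>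
      rw [Finsupp.degree_single] at h
      subst h
      rw [← mul_one c, ← C_mul_monomial, map_mul, ← zero_add (a : ℤ)]
      refine .mul ?_ ?_
      · have : (mulOp (C c) : DiffOp K n) = algebraMap K _ c := mulOp.commutes c
        rw [this]
        exact .const c
      · clear c
        rw [← X_pow_eq_monomial]
        induction a with
        | zero =>
          have : (mulOp (X i ^ 0) : DiffOp K n) = algebraMap K _ 1 := by simp
          rw [this]
          exact .const 1
        | succ a ih =>
          rw [pow_succ, map_mul, Nat.cast_succ]
          exact .mul ih (.var i)
  · intro f g hf hg
    rw [map_add]; exact .add hf hg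

/-- The polynomial ring `R` as a graded `𝒟`-module. -/
noncomputable abbrev polyModule (K : Type u) [Field K] (n : ℕ) : GradedDModule K n where
  carrier := MvPolynomial (Fin n) K
  deg := polyDeg K n
  isInternal := by
    refine isInternal_of_iSup _ (fun g => ?_) fun s c hc h0 j hj => ?_
    · rw [g.as_sum]
      exact sum_mem fun m _ => AddSubgroup.mem_iSup_of_mem _ (monomial_mem_polyDeg rfl _)
    · ext m
      by_contra hm
      have h1 : (m.degree : ℤ) = j := hc j m (mem_support_iff.2 hm)
      have h2 := congrArg (coeff m) h0
      rw [coeff_sum, Finset.sum_eq_single j] at h2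
      · exact hm h2
      · intro k _ hk
        by_contra h3
        exact hk ((hc k m (mem_support_iff.2 h3)).symm.trans h1)
      · exact fun h => absurd hj h
  smul_mem := by
    refine smul_mem_of_generators (fun c j z hz => ?_) (fun i j z hz => ?_) fun i a j z hz => ?_
    · have : algebraMap K (DiffOp K n) c • z = C c * z := by
        rw [algebraMap_smul, smul_eq_C_mul]
      rw [this, ← zero_add j]
      exact mul_mem_polyDeg (monomial_mem_polyDeg (by simp) _) hz
    · exact mul_mem_polyDeg (monomial_mem_polyDeg (by simp) _) hz
    · exact partialDeriv_mem_polyDeg i a hz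

namespace GradedDModule

/-- The shift `M(ℓ)`, with `M(ℓ)ⱼ = M_{ℓ + j}`. -/
abbrev shift (M : GradedDModule K n) (l : ℤ) : GradedDModule K n where
  carrier := M.carrier
  deg j := M.deg (l + j)
  isInternal := by
    refine isInternal_of_iSup _ (fun m => ?_) fun s c hc h0 => ?_
    · have := (Equiv.addLeft l).iSup_comp (g := M.deg)
      simp only [Equiv.coe_addLeft] at this
      rw [this]
      exact mem_iSup_of_isInternal M.isInternal m
    · exact eq_zero_of_isInternal M.isInternal l s c (fun j _ => by rw [add_comm]; exact hc j) h0
  smul_mem {k j P z} hP hz := by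
    rw [add_left_comm]
    exact M.smul_mem hP hz

/-- A finite direct sum of graded `𝒟`-modules. -/
noncomputable abbrev pi {ι : Type} [Finite ι] (M : ι → GradedDModule K n) : GradedDModule K n where
  carrier := ∀ i, (M i).carrier
  deg j := AddSubgroup.pi Set.univ fun i => (M i).deg j
  isInternal := by
    classical
    have := Fintype.ofFinite ι
    refine isInternal_of_iSup _ (fun m => ?_) fun s c hc h0 j hj => ?_
    · rw [← Finset.univ_sum_single m]
      refine sum_mem fun i _ => ?_
      generalize m i = y
      induction mem_iSup_of_isInternal (M i).isInternal y using iSup_induction_deg with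
      | mem j x hx =>
        refine AddSubgroup.mem_iSup_of_mem j fun k _ => ?_
        by_cases hk : k = i
        · subst hk; simpa using hx
        · rw [Pi.single_eq_of_ne hk]; exact zero_mem ((M k).deg j)
      | zero => rw [Pi.single_zero]; exact zero_mem _
      | add x y _ _ hx hy => rw [Pi.single_add]; exact add_mem hx hy
    · funext i
      refine eq_zero_of_isInternal (M i).isInternal 0 s (fun j => c j i)
        (fun j _ => by rw [add_zero]; exact hc j i trivial) ?_ j hj
      have := congrFun h0 i
      rwa [Finset.sum_apply] at this
  smul_mem hP hz i _ := (M i).smul_mem hP (hz i trivial)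

/-- A submodule is homogeneous if it contains the homogeneous components of its elements, that is,
if it is generated as a group by homogeneous elements. -/
def IsHomogeneousSub (M : GradedDModule K n) (N : Submodule (DiffOp K n) M.carrier) : Prop :=
  ∀ z ∈ N, z ∈ ⨆ j, M.deg j ⊓ N.toAddSubgroup

theorem IsHomogeneousSub.mem_of_sum_mem {M : GradedDModule K n}
    {N : Submodule (DiffOp K n) M.carrier} (hN : M.IsHomogeneousSub N) (s : Finset ℤ)
    (c : ℤ → M.carrier) (hc : ∀ j, c j ∈ M.deg j) (h : ∑ j ∈ s, c j ∈ N) : ∀ j ∈ s, c j ∈ N := by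
  classical
  intro j hj
  obtain ⟨t, d, h1, h2, h3⟩ := exists_sum_of_mem_iSup (hN _ h)
  have h4 : ∑ k ∈ s ∪ t, ((if k ∈ s then c k else 0) - d k) = 0 := by
    rw [Finset.sum_sub_distrib, sub_eq_zero,
      ← Finset.sum_subset (Finset.subset_union_right (s₁ := s)) fun k _ hk => h2 k hk, h3,
      Finset.sum_ite_mem, Finset.union_inter_cancel_left]
  have h5 := eq_zero_of_isInternal M.isInternal 0 _ _ (fun k _ => by
    rw [add_zero]
    refine sub_mem ?_ (h1 k).1
    split_ifs
    · exact hc k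
    · exact zero_mem _) h4 j (Finset.mem_union_left _ hj)
  rw [if_pos hj, sub_eq_zero] at h5
  rw [h5]
  exact (h1 j).2

/-- A homogeneous submodule as a graded `𝒟`-module. -/
noncomputable abbrev sub (M : GradedDModule K n) (N : Submodule (DiffOp K n) M.carrier)
    (hN : M.IsHomogeneousSub N) : GradedDModule K n where
  carrier := N
  deg j := (M.deg j).comap N.subtype.toAddMonoidHom
  isInternal := by
    refine isInternal_of_iSup _ (fun m => ?_) fun s c hc h0 j hj => ?_
    · obtain ⟨m, hm⟩ := m
      have : ∃ h : m ∈ N, (⟨m, h⟩ : N) ∈ ⨆ j, (M.deg j).comap N.subtype.toAddMonoidHom := by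
        have hm' := hN m hm
        clear hm
        induction hm' using iSup_induction_deg with
        | mem j x hx => exact ⟨hx.2, AddSubgroup.mem_iSup_of_mem j hx.1⟩
        | zero => exact ⟨zero_mem _, zero_mem _⟩
        | add x y _ _ hx hy =>
          obtain ⟨h1, h2⟩ := hx
          obtain ⟨h3, h4⟩ := hy
          exact ⟨add_mem h1 h3, add_mem h2 h4⟩
      exact this.2
    · refine Subtype.ext (eq_zero_of_isInternal M.isInternal 0 s (fun j => (c j : M.carrier))
        (fun j _ => by rw [add_zero]; exact hc j) ?_ j hj)
      rw [← AddSubmonoidClass.coe_finsetSum, h0]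
      rfl
  smul_mem hP hz := M.smul_mem hP hz

/-- The quotient by a homogeneous submodule as a graded `𝒟`-module. -/
noncomputable abbrev quot (M : GradedDModule K n) (N : Submodule (DiffOp K n) M.carrier)
    (hN : M.IsHomogeneousSub N) : GradedDModule K n where
  carrier := M.carrier ⧸ N
  deg j := (M.deg j).map N.mkQ.toAddMonoidHom
  isInternal := by
    refine isInternal_of_iSup _ (fun m => ?_) fun s c hc h0 j hj => ?_
    · obtain ⟨m, rfl⟩ := N.mkQ_surjective m
      induction mem_iSup_of_isInternal M.isInternal m using iSup_induction_deg with
      | mem j x hx => exact AddSubgroup.mem_iSup_of_mem j ⟨x, hx, rfl⟩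
      | zero => rw [map_zero]; exact zero_mem _
      | add x y _ _ hx hy => rw [map_add]; exact add_mem hx hy
    · choose z hz hz' using hc
      have h1 : ∑ j ∈ s, z j ∈ N := by
        rw [← Submodule.Quotient.mk_eq_zero, ← Submodule.mkQ_apply, map_sum, ← h0]
        exact Finset.sum_congr rfl fun j _ => hz' j
      rw [← hz' j]
      exact (Submodule.Quotient.mk_eq_zero N).2 (hN.mem_of_sum_mem s z hz h1 j hj)
  smul_mem := by
    rintro k j P _ hP ⟨z, hz, rfl⟩
    exact ⟨P • z, M.smul_mem hP hz, map_smul N.mkQ P z⟩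

/-- Degree-preserving maps. -/
def IsGradedHom (M N : GradedDModule K n) (φ : M.carrier →ₗ[DiffOp K n] N.carrier) : Prop :=
  ∀ (j : ℤ), ∀ z ∈ M.deg j, φ z ∈ N.deg j

theorem IsGradedHom.ker {M N : GradedDModule K n} {φ : M.carrier →ₗ[DiffOp K n] N.carrier}
    (hφ : IsGradedHom M N φ) : M.IsHomogeneousSub (LinearMap.ker φ) := by
  intro z hz
  obtain ⟨s, c, hc, -, rfl⟩ := exists_sum_of_mem_iSup (mem_iSup_of_isInternal M.isInternal z)
  rw [LinearMap.mem_ker, map_sum] at hz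
  have := eq_zero_of_isInternal N.isInternal 0 s _
    (fun j _ => by rw [add_zero]; exact hφ j _ (hc j)) hz
  exact sum_mem fun j hj => AddSubgroup.mem_iSup_of_mem j ⟨hc j, this j hj⟩

theorem IsGradedHom.range {M N : GradedDModule K n} {φ : M.carrier →ₗ[DiffOp K n] N.carrier}
    (hφ : IsGradedHom M N φ) : N.IsHomogeneousSub (LinearMap.range φ) := by
  rintro _ ⟨z, rfl⟩
  obtain ⟨s, c, hc, -, rfl⟩ := exists_sum_of_mem_iSup (mem_iSup_of_isInternal M.isInternal z)
  rw [map_sum]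
  exact sum_mem fun j hj => AddSubgroup.mem_iSup_of_mem j ⟨hφ j _ (hc j), ⟨_, rfl⟩⟩

theorem isHomogeneousSub_bot (M : GradedDModule K n) : M.IsHomogeneousSub ⊥ := by
  intro z hz
  rw [(Submodule.mem_bot _).1 hz]
  exact zero_mem _

theorem isHomogeneousSub_iSup (M : GradedDModule K n) {ι : Type*}
    {N : ι → Submodule (DiffOp K n) M.carrier} (hN : ∀ i, M.IsHomogeneousSub (N i)) :
    M.IsHomogeneousSub (⨆ i, N i) := by
  intro z hz
  induction hz using Submodule.iSup_induction' with
  | mem i x hx =>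
    have hle : (⨆ j, M.deg j ⊓ (N i).toAddSubgroup) ≤
        ⨆ j, M.deg j ⊓ (⨆ i, N i).toAddSubgroup :=
      iSup_mono fun j => inf_le_inf_left _ fun y hy => Submodule.mem_iSup_of_mem i hy
    exact hle (hN i x hx)
  | zero => exact zero_mem _
  | add x y _ _ hx hy => exact add_mem hx hy

theorem IsHomogeneousSub.comap_subtype {M : GradedDModule K n}
    {N P : Submodule (DiffOp K n) M.carrier} (hN : M.IsHomogeneousSub N)
    (hP : M.IsHomogeneousSub P) : (M.sub N hN).IsHomogeneousSub (P.comap N.subtype) := by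
  intro z hz
  obtain ⟨s, c, hc, -, h⟩ := exists_sum_of_mem_iSup
    (mem_iSup_of_isInternal (M.sub N hN).isInternal z)
  have h1 : ∑ j ∈ s, N.subtype (c j) ∈ P := by
    have h0 : ∑ j ∈ s, N.subtype (c j) = N.subtype z :=
      (map_sum N.subtype (fun j => (c j : N)) s).symm.trans (congrArg N.subtype h)
    rw [h0]
    exact hz
  have h2 := hP.mem_of_sum_mem s (fun j => N.subtype (c j)) hc h1
  rw [← h]
  exact sum_mem fun j hj => AddSubgroup.mem_iSup_of_mem j ⟨hc j, h2 j hj⟩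

end GradedDModule

end Constructions

section OreLift

open OreLocalization

variable {A : Type*} [Ring A] {S : Submonoid A} [OreSet S]
variable {Y : Type*} [AddCommGroup Y] [Module A Y] {N : Type*} [AddCommGroup N] [Module A N]

theorem smul_oreDiv_self (s : S) (z : Y) : (s : A) • (z /ₒ s) = z /ₒ (1 : S) := by
  rw [← oreDiv_one_smul, OreLocalization.smul_cancel]

theorem ore_smul_bijective (s : S) : Function.Bijective fun y : OreLocalization S Y => (s : A) • y := by
  have h1 : ∀ y : OreLocalization S Y, (s : A) • y = ((s : A) /ₒ (1 : S)) • y := fun y =>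
    (oreDiv_one_smul _ _).symm
  have h2 : ((1 : A) /ₒ s) * ((s : A) /ₒ (1 : S)) = 1 := by simp
  have h3 : ((s : A) /ₒ (1 : S)) * ((1 : A) /ₒ s) = 1 := by
    have := OreLocalization.mul_inv s (1 : S)
    simpa using this
  constructor
  · intro y z hyz
    simp only [h1] at hyz
    have := congrArg (fun w => ((1 : A) /ₒ s) • w) hyz
    simpa only [smul_smul, h2, one_smul] using this
  · intro y
    exact ⟨((1 : A) /ₒ s) • y, by simp only [h1, smul_smul, h3, one_smul]⟩

theorem oreDiv_one_eq_zero {z : Y} (h : z /ₒ (1 : S) = (0 : OreLocalization S Y)) :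
    ∃ s : S, (s : A) • z = 0 := by
  rw [← OreLocalization.zero_oreDiv 1, oreDiv_eq_iff] at h
  obtain ⟨u, v, h1, h2⟩ := h
  have hv : v = (u : A) := by simpa using h2.symm
  refine ⟨u, ?_⟩
  rw [← hv, ← h1, smul_zero]

theorem oreDiv_one_smul_add (a : A) (y z : Y) :
    (a • y + z) /ₒ (1 : S) = a • (y /ₒ (1 : S)) + z /ₒ (1 : S) := by
  rw [← add_oreDiv, smul_oreDiv_one]

/-- The canonical map to the localization. -/
def oreMk (S : Submonoid A) [OreSet S] (Y : Type*) [AddCommGroup Y] [Module A Y] :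
    Y →ₗ[A] OreLocalization S Y where
  toFun y := y /ₒ 1
  map_add' _ _ := add_oreDiv.symm
  map_smul' a y := (smul_oreDiv_one a y).symm

/-- The universal property of the localization of modules at an Ore set: a linear map into a module
on which the elements of `S` act bijectively extends to the localization, by
`z / s ↦ s⁻¹ φ(z)`. -/
noncomputable def oreLift (φ : Y →ₗ[A] N) (h : ∀ s : S, Function.Bijective fun y : N => (s : A) • y) :
    OreLocalization S Y →ₗ[A] N :=
  have key : ∀ (z : Y) (s : S), (s : A) • (Equiv.ofBijective _ (h s)).symm (φ z) = φ z :=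
    fun z s => (Equiv.ofBijective _ (h s)).apply_symm_apply (φ z)
  let F : OreLocalization S Y → N := OreLocalization.liftExpand
    (fun z s => (Equiv.ofBijective _ (h s)).symm (φ z)) (by
      intro z t s ht
      apply (h ⟨t * s, ht⟩).1
      change (t * (s : A)) • _ = (t * (s : A)) • _
      have := key (t • z) ⟨t * s, ht⟩
      change (t * (s : A)) • _ = _ at this
      rw [this, mul_smul, key, map_smul])
  have hF : ∀ (z : Y) (s : S), (s : A) • F (z /ₒ s) = φ z := key
  { toFun := F
    map_add' := by
      intro x y
      induction x with | _ z s
      induction y with | _ w t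
      obtain ⟨a, b, hab, he⟩ := oreDivAddChar' z w s t
      rw [he]
      apply (h (b * s)).1
      change ((b * s : S) : A) • _ = ((b * s : S) : A) • _
      rw [hF, smul_add, Submonoid.coe_mul, mul_smul, hF, hab, mul_smul, hF,
        Submonoid.smul_def, map_add, map_smul, map_smul]
    map_smul' := by
      intro a x
      induction x with | _ z s
      have he : a • (z /ₒ s) = (oreNum a s • z) /ₒ oreDenom a s := by
        rw [smul_oreDiv]
        simp
      apply (h (oreDenom a s)).1
      change (oreDenom a s : A) • _ = (oreDenom a s : A) • _
      rw [he, hF, map_smul, RingHom.id_apply, ← mul_smul, ore_eq, mul_smul, hF] }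

theorem smul_oreLift (φ : Y →ₗ[A] N) (h : ∀ s : S, Function.Bijective fun y : N => (s : A) • y)
    (z : Y) (s : S) : (s : A) • oreLift φ h (z /ₒ s) = φ z :=
  (Equiv.ofBijective _ (h s)).apply_symm_apply (φ z)

end OreLift

section Localization

open OreLocalization

variable {K : Type u} [Field K] {n : ℕ}

/-- The localization `M_f` of a `𝒟`-module `M` at the powers of a polynomial `f`, with its natural
`𝒟`-module structure. -/
abbrev Loc (f : MvPolynomial (Fin n) K) (M : Type u) [AddCommGroup M] [Module (DiffOp K n) M] :
    Type u :=
  OreLocalization (Submonoid.powers (mulOp f : DiffOp K n)) M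

/-- The element `z / fᵗ` of `M_f`. -/
noncomputable def Loc.mk {f : MvPolynomial (Fin n) K} {M : Type u} [AddCommGroup M]
    [Module (DiffOp K n) M] (z : M) (t : ℕ) : Loc f M :=
  z /ₒ (⟨mulOp f ^ t, t, rfl⟩ : Submonoid.powers (mulOp f : DiffOp K n))

section

variable {f : MvPolynomial (Fin n) K} {M : Type u} [AddCommGroup M] [Module (DiffOp K n) M]

theorem Loc.exists_mk (y : Loc f M) : ∃ z t, y = Loc.mk z t := by
  induction y using OreLocalization.ind with
  | _ z s =>
    obtain ⟨_, t, rfl⟩ := s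
    exact ⟨z, t, rfl⟩

theorem Loc.pow_bijective (t : ℕ) :
    Function.Bijective fun y : Loc f M => (mulOp f ^ t : DiffOp K n) • y :=
  ore_smul_bijective (⟨mulOp f ^ t, t, rfl⟩ : Submonoid.powers (mulOp f : DiffOp K n))

theorem Loc.pow_smul_mk (z : M) (t : ℕ) :
    (mulOp f ^ t : DiffOp K n) • (Loc.mk z t : Loc f M) = oreMk _ M z :=
  smul_oreDiv_self (⟨mulOp f ^ t, t, rfl⟩ : Submonoid.powers (mulOp f : DiffOp K n)) z

theorem Loc.eq_mk_iff (y : Loc f M) (z : M) (t : ℕ) :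
    y = Loc.mk z t ↔ (mulOp f ^ t : DiffOp K n) • y = oreMk _ M z := by
  rw [← Loc.pow_smul_mk z t]
  exact (Loc.pow_bijective t).1.eq_iff.symm

end

theorem mulOp_comm (f g : MvPolynomial (Fin n) K) :
    (mulOp f * mulOp g : DiffOp K n) = mulOp g * mulOp f := by
  rw [← map_mul, ← map_mul, mul_comm]

namespace GradedDModule

variable (M : GradedDModule K n)

theorem pow_smul_mem {f : MvPolynomial (Fin n) K} {e : ℕ} (hf : f.IsHomogeneous e) (t : ℕ) {j : ℤ}
    {z : M.carrier} (hz : z ∈ M.deg j) :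
    (mulOp f ^ t : DiffOp K n) • z ∈ M.deg (j + t * e) := by
  induction t with
  | zero => simpa using hz
  | succ t ih =>
    rw [pow_succ', mul_smul]
    have := M.smul_mem (isHomogeneousOp_mulOp (mem_polyDeg_of_isHomogeneous hf)) ih
    rwa [show (e : ℤ) + (j + t * e) = j + (t + 1 : ℕ) * e by push_cast; ring] at this

/-- The homogeneous elements of degree `j` of `M_f`, where `f` is homogeneous of degree `e`: the
fractions `z / fᵗ` with `z` homogeneous of degree `j + t e`. -/
noncomputable def locDeg (f : MvPolynomial (Fin n) K) (e : ℕ) (hf : f.IsHomogeneous e) (j : ℤ) :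
    AddSubgroup (Loc f M.carrier) where
  carrier := {y | ∃ (z : M.carrier) (t : ℕ), z ∈ M.deg (j + t * e) ∧ y = Loc.mk z t}
  zero_mem' := ⟨0, 0, zero_mem _, ((Loc.eq_mk_iff _ _ _).2 (by simp))⟩
  add_mem' := by
    rintro x y ⟨z, t, hz, hx⟩ ⟨w, s, hw, hy⟩
    rw [Loc.eq_mk_iff] at hx hy
    refine ⟨(mulOp f ^ s : DiffOp K n) • z + (mulOp f ^ t : DiffOp K n) • w, t + s,
      add_mem ?_ ?_, (Loc.eq_mk_iff _ _ _).2 ?_⟩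
    · have := M.pow_smul_mem hf s hz
      rwa [show j + t * e + s * e = j + (t + s : ℕ) * e by push_cast; ring] at this
    · have := M.pow_smul_mem hf t hw
      rwa [show j + s * e + t * e = j + (t + s : ℕ) * e by push_cast; ring] at this
    · rw [smul_add, map_add, map_smul, map_smul, ← hx, ← hy, smul_smul, smul_smul, ← pow_add,
        ← pow_add, add_comm s t]
  neg_mem' := by
    rintro x ⟨z, t, hz, hx⟩
    rw [Loc.eq_mk_iff] at hx
    exact ⟨-z, t, neg_mem hz, (Loc.eq_mk_iff _ _ _).2 (by rw [smul_neg, hx, map_neg])⟩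

variable {f : MvPolynomial (Fin n) K} {e : ℕ} (hf : f.IsHomogeneous e)

theorem mem_locDeg {j : ℤ} {y : Loc f M.carrier} : y ∈ M.locDeg f e hf j ↔
    ∃ (z : M.carrier) (t : ℕ), z ∈ M.deg (j + t * e) ∧
      (mulOp f ^ t : DiffOp K n) • y = oreMk _ M.carrier z := by
  simp only [← Loc.eq_mk_iff]
  rfl

/-- A common denominator may be taken larger. -/
theorem exists_of_mem_locDeg {j : ℤ} {y : Loc f M.carrier} (hy : y ∈ M.locDeg f e hf j) :
    ∃ t₀ : ℕ, ∀ t ≥ t₀, ∃ z ∈ M.deg (j + t * e),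
      (mulOp f ^ t : DiffOp K n) • y = oreMk _ M.carrier z := by
  obtain ⟨z, t₀, hz, hy⟩ := (M.mem_locDeg hf).1 hy
  refine ⟨t₀, fun t ht => ?_⟩
  obtain ⟨r, rfl⟩ := Nat.exists_eq_add_of_le ht
  refine ⟨(mulOp f ^ r : DiffOp K n) • z, ?_, ?_⟩
  · have := M.pow_smul_mem hf r hz
    rwa [show j + t₀ * e + r * e = j + (t₀ + r : ℕ) * e by push_cast; ring] at this
  · rw [map_smul, ← hy, smul_smul, ← pow_add, add_comm]

theorem mem_locDeg_of_pow_smul_mem {j : ℤ} {y : Loc f M.carrier} (t : ℕ)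
    (h : (mulOp f ^ t : DiffOp K n) • y ∈ M.locDeg f e hf (j + t * e)) :
    y ∈ M.locDeg f e hf j := by
  obtain ⟨z, s, hz, hy⟩ := (M.mem_locDeg hf).1 h
  refine (M.mem_locDeg hf).2 ⟨z, s + t, ?_, ?_⟩
  · rwa [show j + t * e + s * e = j + (s + t : ℕ) * e by push_cast; ring] at hz
  · rw [pow_add, mul_smul, hy]

theorem oreMk_mem_locDeg {j : ℤ} {z : M.carrier} (hz : z ∈ M.deg j) :
    oreMk _ M.carrier z ∈ M.locDeg f e hf j :=
  (M.mem_locDeg hf).2 ⟨z, 0, by simpa using hz, by simp⟩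

theorem mulOp_smul_mem_locDeg {j k : ℤ} {g : MvPolynomial (Fin n) K} (hg : g ∈ polyDeg K n k)
    {y : Loc f M.carrier} (hy : y ∈ M.locDeg f e hf j) :
    (mulOp g : DiffOp K n) • y ∈ M.locDeg f e hf (k + j) := by
  obtain ⟨z, t, hz, hy⟩ := (M.mem_locDeg hf).1 hy
  refine (M.mem_locDeg hf).2 ⟨(mulOp g : DiffOp K n) • z, t, ?_, ?_⟩
  · rw [add_assoc]
    exact M.smul_mem (isHomogeneousOp_mulOp hg) hz
  · rw [map_smul, ← hy, smul_smul, smul_smul, ← map_pow, mulOp_comm]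

theorem partialOp_smul_mem_locDeg (i : Fin n) (a : ℕ) {j : ℤ} {y : Loc f M.carrier}
    (hy : y ∈ M.locDeg f e hf j) :
    (partialOp i a : DiffOp K n) • y ∈ M.locDeg f e hf (-(a : ℤ) + j) := by
  induction a using Nat.strong_induction_on with
  | _ a ih =>
    obtain ⟨z, t, hz, h⟩ := (M.mem_locDeg hf).1 hy
    have h1 := partialOp_mul_mulOp i a (f ^ t)
    rw [← Finset.add_sum_erase _ _
      (show ((0, a) : ℕ × ℕ) ∈ Finset.HasAntidiagonal.antidiagonal a by simp)] at h1
    simp only [partialDeriv_zero, Module.End.one_apply] at h1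
    have h2 := congrArg (fun P : DiffOp K n => P • y) h1
    simp only [mul_smul, add_smul, Finset.sum_smul] at h2
    rw [map_pow, h, ← map_smul, ← sub_eq_iff_eq_add] at h2
    apply M.mem_locDeg_of_pow_smul_mem hf t
    rw [← h2]
    have hft : f ^ t ∈ polyDeg K n (t * e) := by
      have := mem_polyDeg_of_isHomogeneous (hf.pow t)
      rwa [mul_comm, Nat.cast_mul] at this
    refine sub_mem (M.oreMk_mem_locDeg hf ?_) (sum_mem fun p hp => ?_)
    · rw [add_assoc]
      exact M.smul_mem (.deriv i a) hz
    · obtain ⟨b, c⟩ := p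
      simp only [Finset.mem_erase, Finset.HasAntidiagonal.mem_antidiagonal, ne_eq,
        Prod.mk.injEq] at hp
      have h3 := M.mulOp_smul_mem_locDeg hf (partialDeriv_mem_polyDeg i b hft)
        (ih c (by omega))
      rwa [show -(b : ℤ) + t * e + (-(c : ℤ) + j) = -(a : ℤ) + j + t * e by
        rw [← hp.2]; push_cast; ring] at h3

/-- The localization `M_f` of a graded `𝒟`-module at a homogeneous polynomial `f` of degree `e`, with
`deg (z / fᵗ) = deg z - t e`. -/
noncomputable abbrev loc (f : MvPolynomial (Fin n) K) (e : ℕ) (hf : f.IsHomogeneous e) :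
    GradedDModule K n where
  carrier := Loc f M.carrier
  deg := M.locDeg f e hf
  isInternal := by
    refine isInternal_of_iSup _ (fun y => ?_) fun s c hc h0 j hj => ?_
    · obtain ⟨z, t, rfl⟩ := Loc.exists_mk y
      obtain ⟨s, c, hc, -, rfl⟩ := exists_sum_of_mem_iSup (mem_iSup_of_isInternal M.isInternal z)
      have : (Loc.mk (∑ j ∈ s, c j) t : Loc f M.carrier) = ∑ j ∈ s, Loc.mk (c j) t := by
        symm
        rw [Loc.eq_mk_iff, Finset.smul_sum, map_sum]
        exact Finset.sum_congr rfl fun j _ => Loc.pow_smul_mk _ _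
      rw [this]
      refine sum_mem fun j _ => AddSubgroup.mem_iSup_of_mem (j - t * e) ⟨c j, t, ?_, rfl⟩
      rw [sub_add_cancel]
      exact hc j
    · choose T hT using fun j => M.exists_of_mem_locDeg hf (hc j)
      choose z hz hz' using fun j => hT j (max (T j) (s.sup T)) (le_max_left _ _)
      have hmax : ∀ j ∈ s, max (T j) (s.sup T) = s.sup T := fun j hj =>
        max_eq_right (Finset.le_sup hj)
      have h1 : oreMk (Submonoid.powers (mulOp f : DiffOp K n)) M.carrier (∑ j ∈ s, z j) = 0 := by
        rw [map_sum, ← smul_zero (mulOp f ^ s.sup T : DiffOp K n), ← h0, Finset.smul_sum]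
        refine Finset.sum_congr rfl fun j hj => ?_
        rw [← hz' j, hmax j hj]
      obtain ⟨⟨_, r, rfl⟩, hr⟩ := oreDiv_one_eq_zero h1
      simp only [Finset.smul_sum] at hr
      have h2 := eq_zero_of_isInternal M.isInternal (s.sup T * e + r * e : ℤ) s
        (fun j => (mulOp f ^ r : DiffOp K n) • z j) (fun j hj => by
          have := M.pow_smul_mem hf r (hz j)
          rw [hmax j hj] at this
          rwa [← add_assoc]) hr j hj
      have h3 : (mulOp f ^ (r + s.sup T) : DiffOp K n) • c j = 0 := by
        have := hz' j
        rw [hmax j hj] at this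
        rw [pow_add, mul_smul, this, ← map_smul]
        exact (congrArg _ h2).trans (map_zero _)
      apply (Loc.pow_bijective (f := f) (M := M.carrier) (r + s.sup T)).1
      simpa using h3
  smul_mem := by
    refine smul_mem_of_generators (fun c j y hy => ?_) (fun i j y hy => ?_) fun i a j y hy => ?_
    · rw [← mulOp.commutes, ← zero_add j]
      exact M.mulOp_smul_mem_locDeg hf (monomial_mem_polyDeg (by simp) c) hy
    · exact M.mulOp_smul_mem_locDeg hf (monomial_mem_polyDeg (by simp) 1) hy
    · exact M.partialOp_smul_mem_locDeg hf i a hy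

end GradedDModule

theorem Loc.pow_bijective_of_mul {f g h : MvPolynomial (Fin n) K} (hfg : f * g = h)
    {M : Type u} [AddCommGroup M] [Module (DiffOp K n) M]
    (s : Submonoid.powers (mulOp f : DiffOp K n)) :
    Function.Bijective fun y : Loc h M => (s : DiffOp K n) • y := by
  obtain ⟨_, t, rfl⟩ := s
  have h1 : ∀ y : Loc h M, (mulOp g ^ t : DiffOp K n) • (mulOp f ^ t : DiffOp K n) • y =
      (mulOp h ^ t : DiffOp K n) • y := fun y => by
    rw [smul_smul, ← map_pow, ← map_pow, ← map_pow, ← map_mul, ← mul_pow, mul_comm g, hfg]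
  have h2 : ∀ y : Loc h M, (mulOp f ^ t : DiffOp K n) • (mulOp g ^ t : DiffOp K n) • y =
      (mulOp h ^ t : DiffOp K n) • y := fun y => by
    rw [smul_smul, ← map_pow, ← map_pow, ← map_pow, ← map_mul, ← mul_pow, hfg]
  constructor
  · intro y z hyz
    apply (Loc.pow_bijective t).1
    have := congrArg (fun w => (mulOp g ^ t : DiffOp K n) • w) hyz
    simpa only [h1] using this
  · intro y
    obtain ⟨z, rfl⟩ := (Loc.pow_bijective t).2 y
    exact ⟨(mulOp g ^ t : DiffOp K n) • z, h2 z⟩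

/-- The natural localization map `M_f → M_h` for `h = f g`: the `𝒟`-linear map with
`z / fᵗ ↦ gᵗ z / hᵗ`. -/
noncomputable def Loc.map {f g h : MvPolynomial (Fin n) K} (hfg : f * g = h)
    (M : Type u) [AddCommGroup M] [Module (DiffOp K n) M] : Loc f M →ₗ[DiffOp K n] Loc h M :=
  oreLift (oreMk _ M) (Loc.pow_bijective_of_mul hfg)

theorem Loc.map_mk {f g h : MvPolynomial (Fin n) K} (hfg : f * g = h)
    {M : Type u} [AddCommGroup M] [Module (DiffOp K n) M] (z : M) (t : ℕ) :
    Loc.map hfg M (Loc.mk z t) = Loc.mk ((mulOp g ^ t : DiffOp K n) • z) t := by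
  rw [Loc.eq_mk_iff, map_smul]
  have h1 : (mulOp f ^ t : DiffOp K n) • Loc.map hfg M (Loc.mk z t) = oreMk _ M z :=
    smul_oreLift (oreMk _ M) (Loc.pow_bijective_of_mul hfg) z ⟨mulOp f ^ t, t, rfl⟩
  rw [← h1, smul_smul, ← map_pow, ← map_pow, ← map_pow, ← map_mul, ← mul_pow, mul_comm g, hfg]

theorem Loc.isGradedHom_map (M : GradedDModule K n) {f g h : MvPolynomial (Fin n) K}
    (hfg : f * g = h) {e e' e'' : ℕ} (hf : f.IsHomogeneous e) (hg : g.IsHomogeneous e')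
    (hh : h.IsHomogeneous e'') (he : e + e' = e'') :
    GradedDModule.IsGradedHom (M.loc f e hf) (M.loc h e'' hh) (Loc.map hfg M.carrier) := by
  rintro j _ ⟨z, t, hz, rfl⟩
  refine ⟨(mulOp g ^ t : DiffOp K n) • z, t, ?_, Loc.map_mk hfg z t⟩
  have := M.pow_smul_mem hg t hz
  rwa [show j + t * e + t * e' = j + t * e'' by rw [← he]; push_cast; ring] at this

end Localization

section Cech

variable {K : Type u} [Field K] {n : ℕ}

theorem isHomogeneous_prod {l : ℕ} {f : Fin l → MvPolynomial (Fin n) K} {e : Fin l → ℕ}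
    (hf : ∀ i, (f i).IsHomogeneous (e i)) (s : Finset (Fin l)) :
    (∏ i ∈ s, f i).IsHomogeneous (∑ i ∈ s, e i) :=
  IsHomogeneous.prod s f e fun i _ => hf i

/-- The natural localization map `M_{f_σ} → M_{f_τ}` for `σ ⊆ τ`, where `f_σ = ∏_{i ∈ σ} fᵢ`. -/
noncomputable def Loc.res {l : ℕ} (f : Fin l → MvPolynomial (Fin n) K) (M : Type u)
    [AddCommGroup M] [Module (DiffOp K n) M] {s t : Finset (Fin l)} (h : s ⊆ t) :
    Loc (∏ i ∈ s, f i) M →ₗ[DiffOp K n] Loc (∏ i ∈ t, f i) M :=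
  Loc.map (g := ∏ i ∈ t \ s, f i) (by rw [mul_comm, Finset.prod_sdiff h]) M

theorem Loc.isGradedHom_res {l : ℕ} {f : Fin l → MvPolynomial (Fin n) K} {e : Fin l → ℕ}
    (hf : ∀ i, (f i).IsHomogeneous (e i)) (M : GradedDModule K n) {s t : Finset (Fin l)}
    (h : s ⊆ t) :
    GradedDModule.IsGradedHom (M.loc _ _ (isHomogeneous_prod hf s))
      (M.loc _ _ (isHomogeneous_prod hf t)) (Loc.res f M.carrier h) :=
  Loc.isGradedHom_map M _ _ (isHomogeneous_prod hf (t \ s)) _ (by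
    rw [add_comm, Finset.sum_sdiff h])

theorem Loc.res_res {l : ℕ} (f : Fin l → MvPolynomial (Fin n) K) {M : Type u}
    [AddCommGroup M] [Module (DiffOp K n) M] {r s t : Finset (Fin l)} (h : r ⊆ s) (h' : s ⊆ t)
    (y : Loc (∏ i ∈ r, f i) M) :
    Loc.res f M h' (Loc.res f M h y) = Loc.res f M (h.trans h') y := by
  obtain ⟨z, k, rfl⟩ := Loc.exists_mk y
  simp only [Loc.res, Loc.map_mk]
  rw [smul_smul, ← map_pow, ← map_pow, ← map_pow, ← map_mul, ← mul_pow, ← Finset.prod_union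
    (Finset.disjoint_of_subset_right Finset.sdiff_subset Finset.sdiff_disjoint),
    Finset.sdiff_union_sdiff_cancel h' h]

/-- The term `⨁_{i₁ < ⋯ < iₚ} M_{f_{i₁} ⋯ f_{iₚ}}` in degree `p` of the Čech complex of `M`. -/
abbrev CechTerm {l : ℕ} (f : Fin l → MvPolynomial (Fin n) K) (M : Type u) [AddCommGroup M]
    [Module (DiffOp K n) M] (p : ℕ) : Type u :=
  (s : {s : Finset (Fin l) // s.card = p}) → Loc (∏ i ∈ s.1, f i) M

/-- The differential of the Čech complex: the component at `t` of the image of `z` is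
`∑_{i ∈ t} ± z_{t \ {i}}`, the sign being `(-1) ^ #{j ∈ t | j < i}`. -/
noncomputable def cechD {l : ℕ} (f : Fin l → MvPolynomial (Fin n) K) (M : Type u) [AddCommGroup M]
    [Module (DiffOp K n) M] (p : ℕ) : CechTerm f M p →ₗ[DiffOp K n] CechTerm f M (p + 1) :=
  { toFun := fun z t => ∑ i : t.1, (-1 : DiffOp K n) ^ (t.1.filter (· < i.1)).card •
      Loc.res f M (Finset.erase_subset i.1 t.1)
        (z ⟨t.1.erase i.1, by rw [Finset.card_erase_of_mem i.2, t.2]; rfl⟩)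
    map_add' := fun y z => by
      funext t
      simp only [Pi.add_apply, map_add, smul_add, Finset.sum_add_distrib]
    map_smul' := fun P z => by
      funext t
      simp only [Pi.smul_apply, map_smul, Finset.smul_sum, RingHom.id_apply]
      refine Finset.sum_congr rfl fun i _ => ?_
      rw [smul_smul, smul_smul, ((Commute.neg_one_left P).pow_left _).eq] }

theorem cechD_apply {l : ℕ} (f : Fin l → MvPolynomial (Fin n) K) (M : Type u) [AddCommGroup M]
    [Module (DiffOp K n) M] (p : ℕ) (z : CechTerm f M p)
    (t : {t : Finset (Fin l) // t.card = p + 1}) :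
    cechD f M p z t = ∑ i : t.1, (-1 : DiffOp K n) ^ (t.1.filter (· < i.1)).card •
      Loc.res f M (Finset.erase_subset i.1 t.1)
        (z ⟨t.1.erase i.1, by rw [Finset.card_erase_of_mem i.2, t.2]; rfl⟩) :=
  rfl

/-- The Čech complex is a complex. -/
theorem cechD_cechD {l : ℕ} (f : Fin l → MvPolynomial (Fin n) K) (M : Type u) [AddCommGroup M]
    [Module (DiffOp K n) M] (p : ℕ) (z : CechTerm f M p) :
    cechD f M (p + 1) (cechD f M p z) = 0 := by
  classical
  funext t
  obtain ⟨t, ht⟩ := t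
  let w : Finset (Fin l) → Loc (∏ i ∈ t, f i) M := fun s =>
    if h : s ⊆ t ∧ s.card = p then Loc.res f M h.1 (z ⟨s, h.2⟩) else 0
  have h1 : cechD f M (p + 1) (cechD f M p z) ⟨t, ht⟩ = ∑ i ∈ t, ∑ k ∈ t.erase i,
      ((-1 : DiffOp K n) ^ (t.filter (· < i)).card * (-1 : DiffOp K n) ^ ((t.erase i).filter (· < k)).card) •
        w ((t.erase i).erase k) := by
    rw [cechD_apply, ← Finset.sum_coe_sort t]
    refine Finset.sum_congr rfl fun i _ => ?_
    rw [cechD_apply, map_sum, Finset.smul_sum, ← Finset.sum_coe_sort (t.erase i.1)]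
    refine Finset.sum_congr rfl fun k _ => ?_
    have hs : (t.erase i.1).erase k.1 ⊆ t ∧ ((t.erase i.1).erase k.1).card = p :=
      ⟨(Finset.erase_subset _ _).trans (Finset.erase_subset _ _), by
        rw [Finset.card_erase_of_mem k.2, Finset.card_erase_of_mem i.2, ht]; rfl⟩
    have hw : w ((t.erase i).erase k) = Loc.res f M hs.1 (z ⟨_, hs.2⟩) := dif_pos hs
    rw [hw, map_smul, Loc.res_res, mul_smul]
  rw [h1, Finset.sum_sigma']
  refine Finset.sum_involution (fun x _ => ⟨x.2, x.1⟩) ?_ ?_ ?_ ?_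
  · rintro ⟨i, k⟩ hx
    simp only [Finset.mem_sigma, Finset.mem_erase] at hx
    obtain ⟨hi, hki, hk⟩ := hx
    simp only
    rw [Finset.erase_right_comm (a := k), ← add_smul]
    have key : ∀ a b : Fin l, a ∈ t → b ∈ t → a < b →
        (-1 : DiffOp K n) ^ (t.filter (· < a)).card * (-1 : DiffOp K n) ^ ((t.erase a).filter (· < b)).card +
        (-1 : DiffOp K n) ^ (t.filter (· < b)).card * (-1 : DiffOp K n) ^ ((t.erase b).filter (· < a)).card = 0 := by
      intro a b ha hb hab
      have e1 : (t.erase b).filter (· < a) = t.filter (· < a) := by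
        ext x
        simp only [Finset.mem_filter, Finset.mem_erase]
        constructor
        · rintro ⟨⟨_, h⟩, h'⟩; exact ⟨h, h'⟩
        · rintro ⟨h, h'⟩; exact ⟨⟨(h'.trans hab).ne, h⟩, h'⟩
      have e2 : (t.filter (· < b)).card = ((t.erase a).filter (· < b)).card + 1 := by
        rw [Finset.filter_erase, Finset.card_erase_add_one]
        exact Finset.mem_filter.2 ⟨ha, hab⟩
      rw [e1, e2, pow_succ, mul_neg_one, neg_mul, ← pow_add, ← pow_add, add_comm, add_comm (_ : ℕ),
        neg_add_cancel]
    rcases lt_or_gt_of_ne hki with h | h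
    · rw [add_comm, key k i hk hi h, zero_smul]
    · rw [key i k hi hk h, zero_smul]
  · rintro ⟨i, k⟩ hx _ h
    simp only [Finset.mem_sigma, Finset.mem_erase] at hx
    exact hx.2.1 (congrArg Sigma.fst h)
  · rintro ⟨i, k⟩ hx
    simp only [Finset.mem_sigma, Finset.mem_erase] at hx ⊢
    exact ⟨hx.2.2, hx.2.1.symm, hx.1⟩
  · rintro ⟨i, k⟩ _
    rfl

theorem cechD_mem {l : ℕ} {f : Fin l → MvPolynomial (Fin n) K} {e : Fin l → ℕ}
    (hf : ∀ i, (f i).IsHomogeneous (e i)) (M : GradedDModule K n) (p : ℕ) {j : ℤ}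
    {z : CechTerm f M.carrier p} (hz : ∀ s, z s ∈ M.locDeg _ _ (isHomogeneous_prod hf s.1) j)
    (t : {t : Finset (Fin l) // t.card = p + 1}) :
    cechD f M.carrier p z t ∈ M.locDeg _ _ (isHomogeneous_prod hf t.1) j := by
  rw [cechD_apply]
  refine sum_mem fun i _ => ?_
  have hcard : (t.1.erase i.1).card = p := by rw [Finset.card_erase_of_mem i.2, t.2]; rfl
  have h1 : Loc.res f M.carrier (Finset.erase_subset i.1 t.1) (z ⟨t.1.erase i.1, hcard⟩) ∈
      M.locDeg _ _ (isHomogeneous_prod hf t.1) j :=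
    Loc.isGradedHom_res hf M (Finset.erase_subset i.1 t.1) j (z ⟨t.1.erase i.1, hcard⟩)
      (hz ⟨t.1.erase i.1, hcard⟩)
  rcases neg_one_pow_eq_or (DiffOp K n) (t.1.filter (· < i.1)).card with h | h
  · rwa [h, one_smul]
  · rw [h, neg_one_smul]
    exact neg_mem h1

/-- A finite system of homogeneous generators of an ideal `J` of `R`, with their degrees. -/
structure HomogeneousGenerators (J : Ideal (MvPolynomial (Fin n) K)) where
  /-- the number of generators -/
  length : ℕ
  /-- the generators -/
  gen : Fin length → MvPolynomial (Fin n) K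
  /-- their degrees -/
  degree : Fin length → ℕ
  isHomogeneous : ∀ i, (gen i).IsHomogeneous (degree i)
  span_eq : Ideal.span (Set.range gen) = J

attribute [local instance] MvPolynomial.gradedAlgebra

/-- Every homogeneous ideal of `R` has a finite system of homogeneous generators. -/
theorem nonempty_homogeneousGenerators (J : Ideal (MvPolynomial (Fin n) K))
    (hJ : J.IsHomogeneous (homogeneousSubmodule (Fin n) K)) :
    Nonempty (HomogeneousGenerators J) := by
  classical
  obtain ⟨S, hS⟩ := (Ideal.IsHomogeneous.iff_exists (homogeneousSubmodule (Fin n) K) J).1 hJ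
  obtain ⟨T, hT, hTJ⟩ := (Submodule.fg_span_iff_fg_span_finset_subset
    (R := MvPolynomial (Fin n) K) (Subtype.val '' S)).1 (by
      have := IsNoetherian.noetherian J
      rw [hS] at this
      exact this)
  have hdeg : ∀ x : T, ∃ e : ℕ, (x : MvPolynomial (Fin n) K).IsHomogeneous e := by
    rintro ⟨x, hx⟩
    obtain ⟨⟨y, e, he⟩, _, rfl⟩ := hT hx
    exact ⟨e, he⟩
  choose e he using hdeg
  refine ⟨⟨T.card, fun i => (T.equivFin.symm i : T), fun i => e (T.equivFin.symm i),
    fun i => he _, ?_⟩⟩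
  rw [hS]
  have : Set.range (fun i => ((T.equivFin.symm i : T) : MvPolynomial (Fin n) K)) = T := by
    ext x
    constructor
    · rintro ⟨i, rfl⟩
      exact (T.equivFin.symm i).2
    · intro hx
      exact ⟨T.equivFin ⟨x, hx⟩, by simp⟩
  rw [this]
  exact hTJ.symm

namespace HomogeneousGenerators

variable {J : Ideal (MvPolynomial (Fin n) K)} (G : HomogeneousGenerators J)
  (M : GradedDModule K n)

/-- The Čech complex of `M` on the given generators as a complex of graded `𝒟`-modules. -/
noncomputable abbrev cech (p : ℕ) : GradedDModule K n :=
  GradedDModule.pi fun s : {s : Finset (Fin G.length) // s.card = p} =>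
    M.loc (∏ i ∈ s.1, G.gen i) (∑ i ∈ s.1, G.degree i) (isHomogeneous_prod G.isHomogeneous s.1)

theorem isGradedHom_cechD (p : ℕ) :
    GradedDModule.IsGradedHom (G.cech M p) (G.cech M (p + 1)) (cechD G.gen M.carrier p) :=
  fun _ _ hz t _ => cechD_mem G.isHomogeneous M p (fun s => hz s trivial) t

/-- The coboundaries in degree `p` of the Čech complex. -/
noncomputable def coboundaries : (p : ℕ) → Submodule (DiffOp K n) (G.cech M p).carrier
  | 0 => ⊥
  | p + 1 => LinearMap.range (cechD G.gen M.carrier p)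

theorem isHomogeneousSub_coboundaries (p : ℕ) :
    (G.cech M p).IsHomogeneousSub (G.coboundaries M p) := by
  cases p with
  | zero => exact GradedDModule.isHomogeneousSub_bot _
  | succ p => exact (G.isGradedHom_cechD M p).range

/-- The cocycles in degree `p` of the Čech complex. -/
noncomputable abbrev cocycles (p : ℕ) : GradedDModule K n :=
  (G.cech M p).sub (LinearMap.ker (cechD G.gen M.carrier p)) (G.isGradedHom_cechD M p).ker

/-- The local cohomology module `H^p_J(M)` of a graded `𝒟`-module `M`, again a graded `𝒟`-module:
the `p`-th cohomology of the Čech complex of `M` on homogeneous generators of `J`. -/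
noncomputable def localCohomology (p : ℕ) : GradedDModule K n :=
  (G.cocycles M p).quot
    ((G.coboundaries M p).comap (LinearMap.ker (cechD G.gen M.carrier p)).subtype)
    ((G.isGradedHom_cechD M p).ker.comap_subtype (G.isHomogeneousSub_coboundaries M p))

end HomogeneousGenerators

/-- The iterated local cohomology module `H^{i₁}_{J₁}(⋯(H^{i_s}_{J_s}(R)))`, where `Jₖ` is given by
the homogeneous generators `G k`. -/
noncomputable def iteratedLocalCohomology : (s : ℕ) → {J : Fin s → Ideal (MvPolynomial (Fin n) K)} →
    (∀ k, HomogeneousGenerators (J k)) → (Fin s → ℕ) → GradedDModule K n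
  | 0, _, _, _ => polyModule K n
  | s + 1, _, G, i =>
    (G 0).localCohomology (iteratedLocalCohomology s (fun k => G k.succ) fun k => i k.succ) (i 0)

variable (K n)

/-- The irrelevant maximal ideal `𝔪 = (x₁, …, xₙ)`. -/
noncomputable def irrelevantIdeal : Ideal (MvPolynomial (Fin n) K) :=
  Ideal.span (Set.range X)

/-- The graded `𝒟`-module `R_{x₁ ⋯ xₙ} / ∑ᵢ R_{x₁ ⋯ x̂ᵢ ⋯ xₙ}` of inverse polynomials: it has the
`K`-basis of the classes of the Laurent monomials `x₁^{j₁} ⋯ xₙ^{jₙ}` with all `jₜ ≤ -1`, and all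
other Laurent monomials are `0` in it. -/
noncomputable def inversePolynomials : GradedDModule K n :=
  ((polyModule K n).loc (∏ i : Fin n, X i) (∑ _ : Fin n, 1)
      (isHomogeneous_prod (isHomogeneous_X K) Finset.univ)).quot
    (⨆ i : Fin n, LinearMap.range
      (Loc.res (X : Fin n → MvPolynomial (Fin n) K) (polyModule K n).carrier
        (Finset.erase_subset i Finset.univ)))
    (GradedDModule.isHomogeneousSub_iSup _ fun _ =>
      (Loc.isGradedHom_res (isHomogeneous_X K) (polyModule K n) _).range)

/-- The graded injective hull `*E` of `R / 𝔪`, with its `𝒟`-module structure: the module of inverse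
polynomials, graded in such a way that `1 / (x₁ ⋯ xₙ)` has degree `0`. -/
noncomputable def gradedInjectiveHull : GradedDModule K n :=
  (inversePolynomials K n).shift (-(n : ℤ))

variable {K n}

/-- `M` is isomorphic, as a graded `𝒟`-module, to a direct sum of copies of `E`; the homogeneous
elements of degree `j` of the direct sum are the families of homogeneous elements of degree `j`. -/
def IsDirectSumOfCopies (M E : GradedDModule K n) : Prop :=
  ∃ (ι : Type u) (φ : M.carrier ≃ₗ[DiffOp K n] (ι →₀ E.carrier)),
    ∀ (j : ℤ) (z : M.carrier), z ∈ M.deg j ↔ ∀ a, φ z a ∈ E.deg j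

/-- The socle `{z | 𝔪 z = 0}` of a `𝒟`-module, as an `R`-module. -/
def socle (M : GradedDModule K n) : Set M.carrier :=
  {z | ∀ r ∈ irrelevantIdeal K n, (mulOp r : DiffOp K n) • z = 0}

end Cech

end GradedD

/-! The proof runs on the Euler operators `E_r = ∑_{|a| = r} x^a ∂^[a]`. A monomial of degree `j` is
an eigenvector of `E_r` with eigenvalue `(j choose r)`, by Vandermonde's identity. A graded module
is called Eulerian if `E_r` acts on its degree `j` part by `(j choose r)` for every `r`. The ring
`R` is Eulerian, and the property passes to homogeneous submodules, quotients, finite products and,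
by the commutation rule `eulerOp_mul_mulOp`, to localizations at homogeneous polynomials. Čech
cohomology is built from these operations, so all iterated local cohomology modules are Eulerian,
and so is the module of inverse polynomials.

The numbers `(j choose r)`, `r ≥ 0`, acting on a nonzero element determine `j`, even in positive
characteristic (`eq_of_choose_smul_eq`). Hence the grading of an Eulerian module is recovered from
its `𝒟`-action (`IsEulerian.mem_deg_iff`), and every `𝒟`-linear isomorphism of Eulerian modules is
automatically graded. If all `xᵢ` kill `s`, then `xᵢᵖ ∂ᵢ^[p] s = (-1)ᵖ s = (-1 choose p) s`, so `E_r
s = (-n choose r) s`: socle elements have degree `-n`.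

It remains to find the ungraded structure. The outermost functor makes `H` torsion for powers of the
variables. A torsion `𝒟`-module is `⨁ₐ ∂^[a] S` with `S` its socle (`multiOpSum_injective`,
`multiOpSum_surjective`), so it is determined by the `K`-dimension of `S`, which may be infinite
(`nonempty_linearEquiv_of_socle`). The inverse polynomials are torsion with socle the line through
`1 / (x₁ ⋯ xₙ)`, so `H` is a direct sum of copies of them, one for each element of a basis of its
socle. -/

namespace GradedD

open MvPolynomial

/-! ### Euler operators and Eulerian modules. -/

section Euler

variable {K : Type u} [Field K] {n : ℕ}

/-- The operator `xᵢᵖ ∂ᵢ^[p]`. -/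
noncomputable def eulerVar (i : Fin n) (p : ℕ) : DiffOp K n :=
  mulOp (X i ^ p) * partialOp i p

/-- The Euler operator `∑ x^a ∂^[a]` of order `r` in a list of variables, the sum being over the
exponents `a` of total degree `r`. -/
noncomputable def euler : List (Fin n) → ℕ → DiffOp K n
  | [], r => if r = 0 then 1 else 0
  | i :: l, r => ∑ p ∈ Finset.HasAntidiagonal.antidiagonal r, eulerVar i p.1 * euler l p.2

/-- A simultaneous eigenvector of the operators `xᵢᵖ ∂ᵢ^[p]` is one of the Euler operators. -/
theorem euler_smul_of_eulerVar_smul {M : Type*} [AddCommGroup M] [Module (DiffOp K n) M] {v : M}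
    {c : Fin n → ℤ} (h : ∀ i p, (eulerVar i p : DiffOp K n) • v = Ring.choose (c i) p • v)
    (l : List (Fin n)) (r : ℕ) :
    (euler l r : DiffOp K n) • v = Ring.choose (l.map c).sum r • v := by
  induction l generalizing r with
  | nil =>
    rw [euler, List.map_nil, List.sum_nil, Ring.choose_zero_ite]
    split_ifs <;> simp
  | cons i l ih =>
    -- The recursion defining `euler` has the shape of Vandermonde's identity for `(c i + ∑ c)
    -- choose r`.
    rw [euler, List.map_cons, List.sum_cons, Ring.add_choose_eq _ (Commute.all _ _),
      Finset.sum_smul, Finset.sum_smul]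
    refine Finset.sum_congr rfl fun p _ => ?_
    rw [mul_smul, ih, smul_comm, h, smul_smul, mul_comm]

theorem mulOp_smul (f g : MvPolynomial (Fin n) K) : (mulOp f : DiffOp K n) • g = f * g := rfl

theorem partialOp_smul (i : Fin n) (j : ℕ) (g : MvPolynomial (Fin n) K) :
    (partialOp i j : DiffOp K n) • g = partialDeriv K n i j g := rfl

theorem eulerVar_smul_monomial (i : Fin n) (p : ℕ) (m : Fin n →₀ ℕ) (c : K) :
    (eulerVar i p : DiffOp K n) • monomial m c = Ring.choose (m i : ℤ) p • monomial m c := by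
  rw [eulerVar, mul_smul, partialOp_smul, mulOp_smul, partialDeriv_monomial, X_pow_eq_monomial,
    monomial_mul, Ring.choose_natCast, one_mul, mul_comm, natCast_zsmul, ← map_nsmul, nsmul_eq_mul]
  -- For `m i < p` the truncated exponent is meaningless, but the binomial coefficient vanishes.
  rcases lt_or_ge (m i) p with h | h
  · simp [Nat.choose_eq_zero_of_lt h]
  · rw [add_tsub_cancel_of_le]
    simpa using h

/-- The Euler operator `∑_{|a| = r} x^a ∂^[a]`. -/
noncomputable abbrev eulerOp (r : ℕ) : DiffOp K n := euler (List.finRange n) r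

theorem eulerOp_smul_of_eulerVar_smul {M : Type*} [AddCommGroup M] [Module (DiffOp K n) M] {v : M}
    {c : Fin n → ℤ} (h : ∀ i p, (eulerVar i p : DiffOp K n) • v = Ring.choose (c i) p • v)
    (r : ℕ) : (eulerOp r : DiffOp K n) • v = Ring.choose (∑ i, c i) r • v := by
  rw [euler_smul_of_eulerVar_smul h, Fin.sum_univ_def]

theorem eulerOp_smul_monomial (r : ℕ) (m : Fin n →₀ ℕ) (c : K) :
    (eulerOp r : DiffOp K n) • monomial m c = Ring.choose (m.degree : ℤ) r • monomial m c := by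
  rw [eulerOp_smul_of_eulerVar_smul fun i p => eulerVar_smul_monomial i p m c,
    Finsupp.degree_eq_sum, Nat.cast_sum]

/-- `M` is Eulerian: on `Mⱼ` the Euler operator of order `r` is multiplication by the binomial
coefficient `(j choose r)`. -/
def IsEulerian (M : GradedDModule K n) : Prop :=
  ∀ (j : ℤ) (z : M.carrier), z ∈ M.deg j → ∀ r : ℕ,
    (eulerOp r : DiffOp K n) • z = Ring.choose j r • z

theorem isEulerian_polyModule : IsEulerian (polyModule K n) := by
  intro j z hz r
  refine polyDeg_induction (fun z : MvPolynomial (Fin n) K =>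
    (eulerOp r : DiffOp K n) • z = Ring.choose j r • z) ?_ ?_ ?_ hz
  · simp
  · intro m c hm
    rw [eulerOp_smul_monomial, hm]
  · intro f g hf hg
    rw [smul_add, smul_add, hf, hg]

/-- `𝒟` acts faithfully on `R`, so the rule can be tested on monomials `xᵐ`. There both sides are
known because `R` is Eulerian, and they agree by Vandermonde's identity for `e + |m|`. -/
theorem eulerOp_mul_mulOp {e : ℤ} {f : MvPolynomial (Fin n) K} (hf : f ∈ polyDeg K n e) (r : ℕ) :
    (eulerOp r : DiffOp K n) * mulOp f = ∑ p ∈ Finset.HasAntidiagonal.antidiagonal r,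
      Ring.choose e p.1 • (mulOp f * eulerOp p.2) := by
  apply DiffOp.toEnd_injective
  refine LinearMap.ext fun g => ?_
  change ((eulerOp r : DiffOp K n) * mulOp f) • g = (∑ p ∈ Finset.HasAntidiagonal.antidiagonal r,
      Ring.choose e p.1 • (mulOp f * eulerOp p.2) : DiffOp K n) • g
  induction g using MvPolynomial.induction_on' with
  | add p q hp hq => rw [smul_add, smul_add, hp, hq]
  | monomial m c =>
    have hm : monomial m c ∈ polyDeg K n m.degree := monomial_mem_polyDeg rfl c
    rw [mul_smul, mulOp_smul, isEulerian_polyModule _ _ (mul_mem_polyDeg hf hm),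
      Ring.add_choose_eq _ (Commute.all _ _), Finset.sum_smul, Finset.sum_smul]
    refine Finset.sum_congr rfl fun p _ => ?_
    rw [smul_assoc, mul_smul, mul_smul (mulOp f), isEulerian_polyModule _ _ hm, smul_comm (mulOp f),
      mulOp_smul]

theorem IsEulerian.sub {M : GradedDModule K n} (hM : IsEulerian M)
    (N : Submodule (DiffOp K n) M.carrier) (hN : M.IsHomogeneousSub N) :
    IsEulerian (M.sub N hN) :=
  fun j z hz r => Subtype.ext (hM j z hz r)

theorem IsEulerian.quot {M : GradedDModule K n} (hM : IsEulerian M)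
    (N : Submodule (DiffOp K n) M.carrier) (hN : M.IsHomogeneousSub N) :
    IsEulerian (M.quot N hN) := by
  rintro j _ ⟨z, hz, rfl⟩ r
  exact congrArg N.mkQ (hM j z hz r)

theorem IsEulerian.pi {ι : Type} [Finite ι] {M : ι → GradedDModule K n}
    (hM : ∀ i, IsEulerian (M i)) : IsEulerian (GradedDModule.pi M) :=
  fun j z hz r => funext fun i => hM i j (z i) (hz i trivial) r

/-- Moving `E_r` past `fᵗ` expresses `E_r (fᵗ y)` through the `fᵗ E_q y` with `q ≤ r`. The left side
is known since `fᵗ y` comes from `M`, the terms with `q < r` are known by induction, and `fᵗ` is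
invertible on `M_f`, which leaves the value of `E_r y`. -/
theorem IsEulerian.loc {M : GradedDModule K n} (hM : IsEulerian M) {f : MvPolynomial (Fin n) K}
    {e : ℕ} (hf : f.IsHomogeneous e) : IsEulerian (M.loc f e hf) := by
  intro j y hy r
  obtain ⟨z, t, hz, h⟩ := (M.mem_locDeg hf).1 hy
  have hft : f ^ t ∈ polyDeg K n (t * e) := by
    have := mem_polyDeg_of_isHomogeneous (hf.pow t)
    rwa [mul_comm, Nat.cast_mul] at this
  induction r using Nat.strong_induction_on with
  | _ r ih =>
    apply (Loc.pow_bijective (f := f) (M := M.carrier) t).1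
    have h1 : (eulerOp r : DiffOp K n) • (mulOp f ^ t : DiffOp K n) • y =
        Ring.choose (t * e + j : ℤ) r • (mulOp f ^ t : DiffOp K n) • y := by
      rw [h, ← map_smul, hM _ z hz, map_zsmul, add_comm]
    rw [← map_pow, ← mul_smul, eulerOp_mul_mulOp hft, Ring.add_choose_eq _ (Commute.all _ _),
      Finset.sum_smul, Finset.sum_smul, ← Finset.add_sum_erase _ _
        (show ((0, r) : ℕ × ℕ) ∈ Finset.HasAntidiagonal.antidiagonal r by simp),
      ← Finset.add_sum_erase _ _
        (show ((0, r) : ℕ × ℕ) ∈ Finset.HasAntidiagonal.antidiagonal r by simp)] at h1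
    -- All terms of order below `r` agree with those of Vandermonde's expansion and cancel; only the
    -- term `(0, r)` is left.
    have h2 : ∀ p ∈ (Finset.HasAntidiagonal.antidiagonal r).erase (0, r),
        (Ring.choose (t * e : ℤ) p.1 • (mulOp (f ^ t) * eulerOp p.2) : DiffOp K n) • y =
        (Ring.choose (t * e : ℤ) p.1 * Ring.choose j p.2) • (mulOp (f ^ t) : DiffOp K n) • y := by
      rintro ⟨a, b⟩ hp
      simp only [Finset.mem_erase, Finset.HasAntidiagonal.mem_antidiagonal, ne_eq,
        Prod.mk.injEq] at hp
      rw [smul_assoc, mul_smul, mul_smul, ih b (by omega), smul_comm (mulOp (f ^ t))]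
    rw [Finset.sum_congr rfl h2, add_left_inj] at h1
    simp only [Ring.choose_zero_right, one_smul, one_mul, mul_smul] at h1
    simp only [← map_pow]
    rw [h1, smul_comm]

theorem isEulerian_localCohomology {J : Ideal (MvPolynomial (Fin n) K)}
    (G : HomogeneousGenerators J) {M : GradedDModule K n} (hM : IsEulerian M) (p : ℕ) :
    IsEulerian (G.localCohomology M p) := by
  unfold HomogeneousGenerators.localCohomology
  exact ((IsEulerian.pi fun _ => hM.loc _).sub _ _).quot _ _

theorem isEulerian_iteratedLocalCohomology (s : ℕ) {J : Fin s → Ideal (MvPolynomial (Fin n) K)}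
    (G : ∀ k, HomogeneousGenerators (J k)) (i : Fin s → ℕ) :
    IsEulerian (iteratedLocalCohomology s G i) := by
  induction s with
  | zero => exact isEulerian_polyModule
  | succ s ih => exact isEulerian_localCohomology _ (ih _ _) _

theorem isEulerian_inversePolynomials : IsEulerian (inversePolynomials K n) := by
  unfold inversePolynomials
  exact (isEulerian_polyModule.loc _).quot _ _

/-- The binomial coefficients `(j choose r)` determine `j`, in every characteristic. -/
theorem le_of_choose_smul_eq {M : Type*} [AddCommGroup M] {z : M} (hz : z ≠ 0) {k j : ℤ}
    (h : ∀ r : ℕ, Ring.choose k r • z = Ring.choose j r • z) : k ≤ j := by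
  by_contra! hlt
  obtain ⟨m, hm⟩ := Int.eq_ofNat_of_zero_le (sub_nonneg.2 hlt.le)
  -- Vandermonde's identity transfers the hypothesis from `k, j` to `k - j, 0`.
  have key : ∀ r : ℕ, Ring.choose (k + -j) r • z = Ring.choose (j + -j) r • z := by
    intro r
    rw [Ring.add_choose_eq _ (Commute.all _ _), Ring.add_choose_eq _ (Commute.all _ _),
      Finset.sum_smul, Finset.sum_smul]
    refine Finset.sum_congr rfl fun p _ => ?_
    rw [mul_comm, mul_smul, h, ← mul_smul, mul_comm]
  -- At order `m = k - j > 0` the two sides are `(m choose m) = 1` and `(0 choose m) = 0`, which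
  -- differ in every characteristic.
  have h1 := key m
  rw [← sub_eq_add_neg, hm, Ring.choose_natCast, Nat.choose_self, add_neg_cancel,
    Ring.choose_zero_pos ℤ (by omega)] at h1
  exact hz (by simpa using h1)

theorem eq_of_choose_smul_eq {M : Type*} [AddCommGroup M] {z : M} (hz : z ≠ 0) {k j : ℤ}
    (h : ∀ r : ℕ, Ring.choose k r • z = Ring.choose j r • z) : k = j :=
  le_antisymm (le_of_choose_smul_eq hz h) (le_of_choose_smul_eq hz fun r => (h r).symm)

/-- In an Eulerian module the grading is determined by the action of the Euler operators. -/
theorem IsEulerian.mem_deg_iff {M : GradedDModule K n} (hM : IsEulerian M) (j : ℤ)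
    (z : M.carrier) :
    z ∈ M.deg j ↔ ∀ r : ℕ, (eulerOp r : DiffOp K n) • z = Ring.choose j r • z := by
  refine ⟨hM j z, fun h => ?_⟩
  obtain ⟨s, c, hc, -, rfl⟩ := exists_sum_of_mem_iSup (mem_iSup_of_isInternal M.isInternal z)
  refine sum_mem fun k hk => ?_
  by_cases h0 : c k = 0
  · rw [h0]; exact zero_mem _
  obtain rfl : k = j := by
    refine eq_of_choose_smul_eq h0 fun r => ?_
    -- The terms are homogeneous of distinct degrees, so each vanishes: every component `c k` has
    -- both eigenvalues.
    have h1 : ∑ k ∈ s, (Ring.choose k r • c k - Ring.choose j r • c k) = 0 := by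
      rw [Finset.sum_sub_distrib, ← Finset.smul_sum, ← h r, Finset.smul_sum, sub_eq_zero]
      exact Finset.sum_congr rfl fun k _ => (hM k _ (hc k) r).symm
    refine sub_eq_zero.1 (eq_zero_of_isInternal M.isInternal 0 s _ (fun k _ => ?_) h1 k hk)
    rw [add_zero]
    exact sub_mem (zsmul_mem (hc k) _) (zsmul_mem (hc k) _)
  exact hc k

end Euler

/-! ### Čech cocycles become coboundaries after multiplication by powers of a generator. -/

section CechTorsion

variable {K : Type u} [Field K] {n : ℕ} {M : Type u} [AddCommGroup M] [Module (DiffOp K n) M]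

theorem mulOp_pow_smul_comm (f g : MvPolynomial (Fin n) K) (a b : ℕ) (z : M) :
    (mulOp f ^ a : DiffOp K n) • (mulOp g ^ b : DiffOp K n) • z =
      (mulOp g ^ b : DiffOp K n) • (mulOp f ^ a : DiffOp K n) • z := by
  rw [smul_smul, smul_smul, ← map_pow, ← map_pow, mulOp_comm]

theorem Loc.smul_mk {f : MvPolynomial (Fin n) K} (g : MvPolynomial (Fin n) K) (z : M) (t : ℕ) :
    (mulOp g : DiffOp K n) • (Loc.mk z t : Loc f M) = Loc.mk ((mulOp g : DiffOp K n) • z) t := by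
  have h := mulOp_pow_smul_comm f g t 1 (Loc.mk z t : Loc f M)
  simp only [pow_one] at h
  rw [Loc.eq_mk_iff, h, Loc.pow_smul_mk, map_smul]

/-- If `z / fᵗ` dies in `M_{fg}`, then `(fg)ᴺ gᵗ z = 0` in `M` for some `N`; as `f` is invertible on
`M_f`, the power `g ^ (N + t)` kills `z / fᵗ`. -/
theorem Loc.exists_pow_smul_eq_zero {f g h : MvPolynomial (Fin n) K} (hfg : f * g = h)
    {y : Loc f M} (hy : Loc.map hfg M y = 0) : ∃ N, (mulOp g ^ N : DiffOp K n) • y = 0 := by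
  obtain ⟨z, t, rfl⟩ := Loc.exists_mk y
  rw [Loc.map_mk] at hy
  have h1 := (Loc.eq_mk_iff _ _ _).1 hy.symm
  rw [smul_zero] at h1
  obtain ⟨⟨_, N, rfl⟩, hN⟩ := oreDiv_one_eq_zero h1.symm
  simp only at hN
  have h2 : (mulOp (g ^ (N + t)) : DiffOp K n) • (mulOp (f ^ N) : DiffOp K n) • z = 0 := by
    rw [← hN, smul_smul, smul_smul, ← map_pow, ← map_pow, ← map_mul, ← map_mul, ← hfg]
    congr 2
    ring
  refine ⟨N + t, (Loc.pow_bijective (f := f) (M := M) (t + N)).1 ?_⟩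
  simp only [smul_zero]
  rw [pow_add, mul_smul, mulOp_pow_smul_comm f g, mulOp_pow_smul_comm f g, mulOp_pow_smul_comm f f,
    Loc.pow_smul_mk, ← map_smul, ← map_smul, ← map_pow, ← map_pow, h2, map_zero]

/-- For `y = z / hᵗ`, multiplication by `gᵗ` clears `g` from the denominator and leaves the image of
`z / fᵗ`. -/
theorem Loc.exists_map_eq {f g h : MvPolynomial (Fin n) K} (hfg : f * g = h) (y : Loc h M) :
    ∃ N, ∃ w : Loc f M, Loc.map hfg M w = (mulOp g ^ N : DiffOp K n) • y := by
  obtain ⟨z, t, rfl⟩ := Loc.exists_mk y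
  exact ⟨t, Loc.mk z t, by rw [Loc.map_mk, ← map_pow, Loc.smul_mk]⟩

variable {l : ℕ} {f : Fin l → MvPolynomial (Fin n) K}

theorem prod_sdiff_erase {t : Finset (Fin l)} {k : Fin l} (hk : k ∈ t) :
    ∏ i ∈ t \ t.erase k, f i = f k := by
  rw [Finset.sdiff_erase hk, Finset.sdiff_self, insert_empty_eq, Finset.prod_singleton]

theorem Loc.exists_pow_smul_eq_zero_of_res {t : Finset (Fin l)} {k : Fin l} (hk : k ∈ t)
    {y : Loc (∏ i ∈ t.erase k, f i) M} (hy : Loc.res f M (Finset.erase_subset k t) y = 0) :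
    ∃ N, (mulOp (f k) ^ N : DiffOp K n) • y = 0 := by
  obtain ⟨N, hN⟩ := Loc.exists_pow_smul_eq_zero _ hy
  rw [prod_sdiff_erase hk] at hN
  exact ⟨N, hN⟩

theorem Loc.exists_res_eq {t : Finset (Fin l)} {k : Fin l} (hk : k ∈ t)
    (y : Loc (∏ i ∈ t, f i) M) : ∃ N, ∃ w : Loc (∏ i ∈ t.erase k, f i) M,
      Loc.res f M (Finset.erase_subset k t) w = (mulOp (f k) ^ N : DiffOp K n) • y := by
  obtain ⟨N, w, hN⟩ := Loc.exists_map_eq (M := M) (f := ∏ i ∈ t.erase k, f i)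
    (g := ∏ i ∈ t \ t.erase k, f i) (h := ∏ i ∈ t, f i)
    (by rw [mul_comm, Finset.prod_sdiff (Finset.erase_subset k t)]) y
  exact ⟨N, w, hN.trans (by rw [prod_sdiff_erase hk])⟩

/-- Erasing any index other than `k` from `t` leaves a set containing `k`, where `x` vanishes; one
term of the differential survives. -/
theorem cechD_apply_of_mem {q : ℕ} {x : CechTerm f M q} {k : Fin l}
    (hx : ∀ s, k ∈ s.1 → x s = 0) (t : {t : Finset (Fin l) // t.card = q + 1}) (hk : k ∈ t.1) :
    cechD f M q x t = (-1 : DiffOp K n) ^ (t.1.filter (· < k)).card •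
      Loc.res f M (Finset.erase_subset k t.1)
        (x ⟨t.1.erase k, by rw [Finset.card_erase_of_mem hk, t.2]; rfl⟩) := by
  rw [cechD_apply, Finset.sum_eq_single (⟨k, hk⟩ : t.1)]
  · rintro ⟨i, hi⟩ _ hik
    rw [hx _ (Finset.mem_erase.2 ⟨fun h => hik (Subtype.ext h.symm), hk⟩), map_zero, smul_zero]
  · exact fun h => absurd (Finset.mem_univ _) h

theorem pow_smul_eq_zero_mono {M : Type*} [AddCommGroup M] [Module (DiffOp K n) M]
    {P : DiffOp K n} {z : M} {a b : ℕ} (hab : a ≤ b)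
    (h : P ^ a • z = 0) : P ^ b • z = 0 := by
  rw [← Nat.sub_add_cancel hab, pow_add, mul_smul, h, smul_zero]

theorem exists_uniform_pow_smul_eq_zero {ι : Type*} [Finite ι] {N : ι → Type*}
    [∀ i, AddCommGroup (N i)] [∀ i, Module (DiffOp K n) (N i)] {P : DiffOp K n} {y : ∀ i, N i}
    (h : ∀ i, ∃ r, P ^ r • y i = 0) : ∃ r, P ^ r • y = 0 := by
  have := Fintype.ofFinite ι
  choose r hr using h
  exact ⟨Finset.univ.sup r, funext fun i =>
    (pow_smul_eq_zero_mono (Finset.le_sup (Finset.mem_univ i)) (hr i) :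
      P ^ Finset.univ.sup r • y i = 0)⟩

/-- A cocycle whose components at the sets containing `k` vanish is `f k`-torsion. -/
theorem exists_pow_smul_cocycle_eq_zero {q : ℕ} {x : CechTerm f M q} {k : Fin l}
    (hx : ∀ s, k ∈ s.1 → x s = 0) (h : cechD f M q x = 0) :
    ∃ N, (mulOp (f k) ^ N : DiffOp K n) • x = 0 := by
  refine exists_uniform_pow_smul_eq_zero fun s => ?_
  by_cases hk : k ∈ s.1
  · exact ⟨0, by rw [hx s hk, smul_zero]⟩
  · have hs : s = ⟨(insert k s.1).erase k, by rw [Finset.erase_insert hk, s.2]⟩ :=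
      Subtype.ext (Finset.erase_insert hk).symm
    rw [hs]
    refine Loc.exists_pow_smul_eq_zero_of_res (Finset.mem_insert_self k s.1) ?_
    -- At `s ∪ {k}` the cocycle condition says that `± x_s` restricts to `0`, so `x_s` is `f
    -- k`-torsion.
    have h1 := cechD_apply_of_mem hx ⟨insert k s.1, by rw [Finset.card_insert_of_notMem hk, s.2]⟩
      (Finset.mem_insert_self k s.1)
    rw [h, Pi.zero_apply] at h1
    rcases neg_one_pow_eq_or (DiffOp K n) ((insert k s.1).filter (· < k)).card with h2 | h2
    · rw [h2, one_smul] at h1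
      exact h1.symm
    · rw [h2, neg_one_smul] at h1
      exact neg_eq_zero.1 h1.symm

/-- Up to a power of `f k`, the components of a cochain at the sets containing `k` are those of a
coboundary. -/
theorem exists_cechD_apply_eq {q : ℕ} (z : CechTerm f M (q + 1)) (k : Fin l) :
    ∃ N, ∃ w : CechTerm f M q, ∀ t, k ∈ t.1 →
      cechD f M q w t = (mulOp (f k) ^ N : DiffOp K n) • z t := by
  -- For `k ∉ s` take `w_s` with restriction `f_kᴺ z_{s ∪ {k}}`, otherwise `w_s = 0`. Quantifying
  -- over `t` with `t \ {k} = s` avoids transport along that equality.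
  have h1 : ∀ s : {s : Finset (Fin l) // s.card = q}, ∃ N, ∃ w : Loc (∏ i ∈ s.1, f i) M,
      (k ∈ s.1 → w = 0) ∧ ∀ (t : {t : Finset (Fin l) // t.card = q + 1}) (hst : s.1 ⊆ t.1),
        k ∈ t.1 → t.1.erase k = s.1 →
          Loc.res f M hst w = (mulOp (f k) ^ N : DiffOp K n) • z t := by
    rintro ⟨s, hs⟩
    by_cases hk : k ∈ s
    · refine ⟨0, 0, fun _ => rfl, fun t _ _ ht => ?_⟩
      simp only at ht
      rw [← ht] at hk
      exact absurd hk (Finset.notMem_erase k t.1)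
    · obtain ⟨t, hkt, rfl⟩ : ∃ t, k ∈ t ∧ t.erase k = s :=
        ⟨insert k s, Finset.mem_insert_self k s, Finset.erase_insert hk⟩
      have ht : t.card = q + 1 := by
        rw [← Finset.card_erase_add_one hkt, hs]
      obtain ⟨N, w, hw⟩ := Loc.exists_res_eq hkt (z ⟨t, ht⟩)
      refine ⟨N, w, fun h => absurd h hk, ?_⟩
      rintro ⟨t', ht'⟩ hst hkt' h
      simp only at hkt' h
      obtain rfl : t' = t := by rw [← Finset.insert_erase hkt', h, Finset.insert_erase hkt]
      exact hw
  choose N w hw0 hw using h1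
  have hle : ∀ s, N s ≤ Finset.univ.sup N := fun s => Finset.le_sup (Finset.mem_univ s)
  -- The power of `f k` makes the exponents uniform in `s`; the sign cancels that of the
  -- differential, since removing `k` does not change the set of indices below `k`.
  refine ⟨Finset.univ.sup N, fun s => (-1 : DiffOp K n) ^ (s.1.filter (· < k)).card •
    (mulOp (f k) ^ (Finset.univ.sup N - N s) : DiffOp K n) • w s, fun t hk => ?_⟩
  rw [cechD_apply_of_mem (k := k) (fun s hs => by rw [hw0 s hs, smul_zero, smul_zero]) t hk]
  simp only
  rw [map_smul, map_smul, hw ⟨t.1.erase k, _⟩ t (Finset.erase_subset k t.1) hk rfl,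
    ← mul_smul (mulOp (f k) ^ _), ← pow_add, Nat.sub_add_cancel (hle _), Finset.filter_erase,
    Finset.erase_eq_of_notMem (by simp), ← mul_smul, ← pow_add,
    Even.neg_one_pow ⟨_, rfl⟩, one_smul]

end CechTorsion

/-! ### Local cohomology at the irrelevant ideal is torsion. -/

section Torsion

variable {K : Type u} [Field K] {n : ℕ}

/-- Inverting `f_k` makes the Čech complex exact. Concretely, `f_kᴺ z - dw` can be made to vanish at
all sets containing `k`; being a cocycle, it is then killed by a further power of `f_k`. In degree
`0` the only index set is empty, and `z` itself is torsion. -/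
theorem HomogeneousGenerators.exists_pow_smul_mem_coboundaries
    {J : Ideal (MvPolynomial (Fin n) K)} (G : HomogeneousGenerators J) (M : GradedDModule K n)
    (p : ℕ) (z : (G.cech M p).carrier) (hz : cechD G.gen M.carrier p z = 0) (k : Fin G.length) :
    ∃ N, (mulOp (G.gen k) ^ N : DiffOp K n) • z ∈ G.coboundaries M p := by
  cases p with
  | zero =>
    obtain ⟨N, hN⟩ := exists_pow_smul_cocycle_eq_zero (k := k) (x := z) (fun s hs => by
      rw [Finset.card_eq_zero.1 s.2] at hs
      exact absurd hs (Finset.notMem_empty k)) hz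
    exact ⟨N, by rw [hN]; exact zero_mem _⟩
  | succ q =>
    obtain ⟨N, w, hw⟩ := exists_cechD_apply_eq z k
    obtain ⟨N', hN'⟩ := exists_pow_smul_cocycle_eq_zero (k := k)
      (x := (mulOp (G.gen k) ^ N : DiffOp K n) • z - cechD G.gen M.carrier q w)
      (fun t ht => by
        rw [Pi.sub_apply, hw t ht]
        exact sub_self _)
      (by rw [map_sub, map_smul, hz, smul_zero, cechD_cechD, sub_zero])
    rw [smul_sub, sub_eq_zero, smul_smul, ← pow_add] at hN'
    refine ⟨N' + N, ?_⟩
    rw [hN']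
    exact Submodule.smul_mem _ _ ⟨w, rfl⟩

/-- Every element is killed by a power of each variable. -/
def IsVarTorsion (K : Type u) [Field K] (n : ℕ) (M : Type*) [AddCommGroup M]
    [Module (DiffOp K n) M] : Prop :=
  ∀ (i : Fin n) (z : M), ∃ N, (mulOp (X i) ^ N : DiffOp K n) • z = 0

/-- The ideal of the polynomials that kill an element of a `𝒟`-module. -/
noncomputable def annIdeal {M : Type*} [AddCommGroup M] [Module (DiffOp K n) M] (z : M) :
    Ideal (MvPolynomial (Fin n) K) where
  carrier := {r | (mulOp r : DiffOp K n) • z = 0}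
  add_mem' := fun {a b} ha hb => by
    simp only [Set.mem_ofPred_eq] at ha hb ⊢
    rw [map_add, add_smul, ha, hb, add_zero]
  zero_mem' := by simp
  smul_mem' := fun c a ha => by
    simp only [Set.mem_ofPred_eq] at ha ⊢
    rw [smul_eq_mul, map_mul, mul_smul, ha, smul_zero]

theorem mem_annIdeal {M : Type*} [AddCommGroup M] [Module (DiffOp K n) M] {z : M}
    {r : MvPolynomial (Fin n) K} : r ∈ annIdeal z ↔ (mulOp r : DiffOp K n) • z = 0 := Iff.rfl

/-- The chosen generators need not be the variables: each lies in the radical of the annihilator of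
`z`, hence so does the whole ideal they generate, and with it every `xᵢ`. -/
theorem HomogeneousGenerators.isVarTorsion_localCohomology
    (G : HomogeneousGenerators (irrelevantIdeal K n)) (M : GradedDModule K n) (p : ℕ) :
    IsVarTorsion K n (G.localCohomology M p).carrier := by
  intro i z
  obtain ⟨⟨y, hy⟩, rfl⟩ := Submodule.mkQ_surjective _ z
  set z := Submodule.mkQ ((G.coboundaries M p).comap
    (LinearMap.ker (cechD G.gen M.carrier p)).subtype) ⟨y, hy⟩ with hz
  have h1 : irrelevantIdeal K n ≤ (annIdeal z).radical := by
    refine G.span_eq.symm.le.trans (Ideal.span_le.2 ?_)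
    rintro _ ⟨k, rfl⟩
    obtain ⟨N, hN⟩ := G.exists_pow_smul_mem_coboundaries M p y hy k
    refine ⟨N, ?_⟩
    rw [mem_annIdeal, map_pow, hz, ← map_smul, Submodule.mkQ_apply, Submodule.Quotient.mk_eq_zero]
    exact hN
  obtain ⟨N, hN⟩ := h1 (Ideal.subset_span ⟨i, rfl⟩)
  refine ⟨N, ?_⟩
  rw [← map_pow]
  exact hN

end Torsion

/-! ### Divided power operators in several variables and their commutation rules. -/

section MultiDeriv

variable {K : Type u} [Field K] {n : ℕ}

/-- The divided power operator `∂^[a] = ∏ᵢ ∂ᵢ^[aᵢ]`. -/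
noncomputable def multiDeriv (a : Fin n →₀ ℕ) : Module.End K (MvPolynomial (Fin n) K) :=
  (basisMonomials (Fin n) K).constr K fun m =>
    monomial (m - a) ((∏ i, (m i).choose (a i) : ℕ) : K)

theorem multiDeriv_monomial (a m : Fin n →₀ ℕ) (c : K) :
    multiDeriv a (monomial m c) = monomial (m - a) (c * ((∏ i, (m i).choose (a i) : ℕ) : K)) := by
  have h : monomial m c = c • (basisMonomials (Fin n) K) m := by
    simp [coe_basisMonomials, smul_monomial]
  rw [h, map_smul, multiDeriv, Module.Basis.constr_basis, smul_monomial, smul_eq_mul]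

theorem prod_choose_add_single (a m : Fin n →₀ ℕ) (i : Fin n) (j : ℕ) :
    ∏ k, (m k).choose ((a + Finsupp.single i j) k) =
      (m i).choose (a i + j) * ∏ k ∈ Finset.univ.erase i, (m k).choose (a k) := by
  rw [← Finset.mul_prod_erase _ _ (Finset.mem_univ i)]
  congr 1
  · simp
  · refine Finset.prod_congr rfl fun k hk => ?_
    rw [Finsupp.add_apply, Finsupp.single_eq_of_ne (Finset.ne_of_mem_erase hk), add_zero]

/-- On monomials this is `(m choose a + j) (a + j choose a) = (m choose a) (m - a choose j)` in the
variable `xᵢ`. -/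
theorem partialDeriv_mul_multiDeriv (i : Fin n) (j : ℕ) (a : Fin n →₀ ℕ) :
    partialDeriv K n i j * multiDeriv a =
      (a i + j).choose j • multiDeriv (a + Finsupp.single i j) := by
  refine (basisMonomials (Fin n) K).ext fun m => ?_
  rw [coe_basisMonomials, Module.End.mul_apply, LinearMap.smul_apply, multiDeriv_monomial,
    multiDeriv_monomial, partialDeriv_monomial, prod_choose_add_single, tsub_add_eq_tsub_tsub,
    ← map_nsmul, one_mul, one_mul, nsmul_eq_mul,
    ← Finset.mul_prod_erase Finset.univ (fun k => (m k).choose (a k)) (Finset.mem_univ i)]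
  congr 1
  norm_cast
  have h : (m i).choose (a i + j) * (a i + j).choose (a i) =
      (m i).choose (a i) * (m i - a i).choose j := by
    rw [Nat.choose_mul (Nat.le_add_right _ _), Nat.add_sub_cancel_left]
  rw [Nat.choose_symm_add] at h
  rw [Finsupp.tsub_apply, ← mul_assoc, mul_comm ((a i + j).choose j), h]
  rw [mul_right_comm]

theorem multiDeriv_zero : multiDeriv (0 : Fin n →₀ ℕ) = (1 : Module.End K _) := by
  refine (basisMonomials (Fin n) K).ext fun m => ?_
  simp [coe_basisMonomials, multiDeriv_monomial]

theorem multiDeriv_single (i : Fin n) (j : ℕ) :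
    multiDeriv (Finsupp.single i j) = partialDeriv K n i j := by
  have h := partialDeriv_mul_multiDeriv (K := K) i j 0
  rw [multiDeriv_zero, mul_one, zero_add, Finsupp.zero_apply, zero_add, Nat.choose_self,
    one_smul] at h
  exact h.symm

/-- The variables are added one at a time: if `xᵢ` does not occur yet, the binomial coefficient in
the product rule is `1`, so nothing has to be divided by. -/
theorem multiDeriv_mem (a : Fin n →₀ ℕ) : multiDeriv a ∈ diffOpAlgebra K n := by
  induction a using Finsupp.induction with
  | zero => rw [multiDeriv_zero]; exact one_mem _
  | single_add i b f hf _ ih =>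
    have h := partialDeriv_mul_multiDeriv (K := K) i b f
    rw [Finsupp.notMem_support_iff.1 hf, zero_add, Nat.choose_self, one_smul, add_comm] at h
    rw [← h]
    exact mul_mem (partialDeriv_mem i b) ih

/-- The operator `∂^[a]` as an element of `𝒟`. -/
noncomputable def multiOp (a : Fin n →₀ ℕ) : DiffOp K n :=
  ⟨multiDeriv a, multiDeriv_mem a⟩

theorem multiOp_zero : (multiOp 0 : DiffOp K n) = 1 :=
  Subtype.ext multiDeriv_zero

theorem multiOp_single (i : Fin n) (j : ℕ) :
    (multiOp (Finsupp.single i j) : DiffOp K n) = partialOp i j :=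
  Subtype.ext (multiDeriv_single i j)

theorem partialOp_mul_multiOp (i : Fin n) (j : ℕ) (a : Fin n →₀ ℕ) :
    (partialOp i j * multiOp a : DiffOp K n) =
      (a i + j).choose j • multiOp (a + Finsupp.single i j) := by
  apply DiffOp.toEnd_injective
  rw [map_nsmul]
  exact partialDeriv_mul_multiDeriv i j a

theorem X_mul_monomial (i : Fin n) (m : Fin n →₀ ℕ) (c : K) :
    X i * monomial m c = monomial (m + Finsupp.single i 1) c := by
  rw [X, monomial_mul, one_mul, add_comm]

theorem toEnd_mulOp (f g : MvPolynomial (Fin n) K) : DiffOp.toEnd K n (mulOp f) g = f * g := rfl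

theorem toEnd_multiOp (a : Fin n →₀ ℕ) (g : MvPolynomial (Fin n) K) :
    DiffOp.toEnd K n (multiOp a) g = multiDeriv a g := rfl

theorem mulOp_X_mul_multiOp_of_eq_zero {i : Fin n} {a : Fin n →₀ ℕ} (ha : a i = 0) :
    (mulOp (X i) * multiOp a : DiffOp K n) = multiOp a * mulOp (X i) := by
  apply DiffOp.toEnd_injective
  refine (basisMonomials (Fin n) K).ext fun m => ?_
  rw [coe_basisMonomials, map_mul, map_mul, Module.End.mul_apply, Module.End.mul_apply,
    toEnd_mulOp, toEnd_mulOp, toEnd_multiOp, toEnd_multiOp, multiDeriv_monomial, X_mul_monomial, X_mul_monomial, multiDeriv_monomial]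
  refine congrArg₂ (fun e c => monomial e c) ?_ ?_
  · ext k
    by_cases hk : k = i
    · subst hk; simp [ha]
    · simp [hk]
  · congr 2
    refine Finset.prod_congr rfl fun k _ => ?_
    by_cases hk : k = i
    · subst hk; simp [ha]
    · simp [hk]

/-- Pascal's rule for `(mᵢ + 1 choose aᵢ + 1)`, read on monomials. -/
theorem multiOp_add_single_mul_mulOp_X (i : Fin n) (a : Fin n →₀ ℕ) :
    (multiOp (a + Finsupp.single i 1) * mulOp (X i) : DiffOp K n) =
      mulOp (X i) * multiOp (a + Finsupp.single i 1) + multiOp a := by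
  apply DiffOp.toEnd_injective
  refine (basisMonomials (Fin n) K).ext fun m => ?_
  rw [coe_basisMonomials, map_add, LinearMap.add_apply, map_mul, map_mul, Module.End.mul_apply,
    Module.End.mul_apply, toEnd_mulOp, toEnd_mulOp, toEnd_multiOp, toEnd_multiOp, toEnd_multiOp,
    X_mul_monomial, multiDeriv_monomial, multiDeriv_monomial, multiDeriv_monomial,
    X_mul_monomial, prod_choose_add_single, prod_choose_add_single,
    ← Finset.mul_prod_erase Finset.univ (fun k => (m k).choose (a k)) (Finset.mem_univ i),
    add_tsub_add_eq_tsub_right, Finsupp.add_apply, Finsupp.single_eq_same, Nat.choose_succ_succ]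
  have h1 : ∏ k ∈ Finset.univ.erase i, ((m + Finsupp.single i 1 : Fin n →₀ ℕ) k).choose (a k) =
      ∏ k ∈ Finset.univ.erase i, (m k).choose (a k) :=
    Finset.prod_congr rfl fun k hk => by
      rw [Finsupp.add_apply, Finsupp.single_eq_of_ne (Finset.ne_of_mem_erase hk), add_zero]
  rw [h1]
  -- For `m i ≤ a i` the truncated exponents need not match, but the term carrying `(m i choose a i
  -- + 1)` is zero.
  rcases lt_or_ge (m i) (a i + 1) with h | h
  · rw [Nat.choose_eq_zero_of_lt h]
    simp
  · have h2 : m - (a + Finsupp.single i 1) + Finsupp.single i 1 = m - a := by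
      ext k
      by_cases hk : k = i
      · subst hk; simp; omega
      · simp [hk]
    rw [h2, ← map_add]
    congr 1
    push_cast
    ring

end MultiDeriv

/-! ### The action of `𝒟` on socle elements. -/

section Socle

variable {K : Type u} [Field K] {n : ℕ} {M : Type*} [AddCommGroup M] [Module (DiffOp K n) M]

theorem mulOp_X_smul_multiOp_smul_of_eq_zero {i : Fin n} {s : M}
    (hs : (mulOp (X i) : DiffOp K n) • s = 0) {a : Fin n →₀ ℕ} (ha : a i = 0) :
    (mulOp (X i) : DiffOp K n) • (multiOp a : DiffOp K n) • s = 0 := by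
  rw [← mul_smul, mulOp_X_mul_multiOp_of_eq_zero ha, mul_smul, hs, smul_zero]

theorem mulOp_X_smul_multiOp_smul {i : Fin n} {s : M}
    (hs : (mulOp (X i) : DiffOp K n) • s = 0) (a : Fin n →₀ ℕ) :
    (mulOp (X i) : DiffOp K n) • (multiOp (a + Finsupp.single i 1) : DiffOp K n) • s =
      -((multiOp a : DiffOp K n) • s) := by
  have h := congrArg (fun P : DiffOp K n => P • s) (multiOp_add_single_mul_mulOp_X i a)
  simp only [mul_smul, add_smul, hs, smul_zero] at h
  exact eq_neg_of_add_eq_zero_left h.symm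

theorem choose_neg_one (p : ℕ) : Ring.choose (-1 : ℤ) p = (-1) ^ p := by
  rw [Ring.choose_neg, add_comm, add_sub_cancel_right, Ring.choose_natCast, Nat.choose_self,
    Int.negOnePow_def]
  simp [Units.smul_def]

/-- Each factor `xᵢ` lowers the order of `∂ᵢ^[p]` on `s` by one at the cost of a sign, so the
eigenvalue is `(-1)ᵖ`: for the Euler operators, `s` has degree `-1` in `xᵢ`. -/
theorem eulerVar_smul_of_mulOp_X_smul {i : Fin n} {s : M}
    (hs : (mulOp (X i) : DiffOp K n) • s = 0) (p : ℕ) :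
    (eulerVar i p : DiffOp K n) • s = Ring.choose (-1 : ℤ) p • s := by
  rw [choose_neg_one]
  induction p with
  | zero => simp [eulerVar, ← multiOp_single, multiOp_zero]
  | succ p ih =>
    have h := mulOp_X_smul_multiOp_smul hs (Finsupp.single i p)
    rw [← Finsupp.single_add, multiOp_single, multiOp_single] at h
    rw [eulerVar, pow_succ, map_mul, mul_assoc, mul_smul, mul_smul, h, smul_neg, ← mul_smul,
      ← eulerVar, ih, pow_succ, mul_neg_one, neg_smul]

theorem eulerOp_smul_of_mulOp_X_smul {s : M} (hs : ∀ i, (mulOp (X i) : DiffOp K n) • s = 0)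
    (r : ℕ) : (eulerOp r : DiffOp K n) • s = Ring.choose (-(n : ℤ)) r • s := by
  rw [eulerOp_smul_of_eulerVar_smul (c := fun _ => -1) fun i p =>
    eulerVar_smul_of_mulOp_X_smul (hs i) p]
  simp

/-- Socle elements of an Eulerian module have degree `-n`. -/
theorem IsEulerian.mem_deg_of_mulOp_X_smul {M : GradedDModule K n} (hM : IsEulerian M)
    {s : M.carrier} (hs : ∀ i, (mulOp (X i) : DiffOp K n) • s = 0) : s ∈ M.deg (-(n : ℤ)) :=
  (hM.mem_deg_iff _ _).2 (eulerOp_smul_of_mulOp_X_smul hs)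

end Socle

/-! ### Torsion `𝒟`-modules are determined by their socles. -/

section Structure

variable {K : Type u} [Field K] {n : ℕ} {V M N : Type*} [AddCommGroup V] [Module K V]
  [AddCommGroup M] [Module K M] [Module (DiffOp K n) M] [IsScalarTower K (DiffOp K n) M]
  [AddCommGroup N] [Module K N] [Module (DiffOp K n) N] [IsScalarTower K (DiffOp K n) N]

/-- The map `⨁ₐ V → M`, `c ↦ ∑ₐ ∂^[a] σ(cₐ)`. -/
noncomputable def multiOpSum (σ : V →ₗ[K] M) : ((Fin n →₀ ℕ) →₀ V) →ₗ[K] M :=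
  have := IsScalarTower.to_smulCommClass' (R := K) (A := DiffOp K n) (M := M)
  Finsupp.lsum K fun a => (Algebra.lsmul K K M (multiOp a : DiffOp K n)) ∘ₗ σ

theorem multiOpSum_single (σ : V →ₗ[K] M) (a : Fin n →₀ ℕ) (v : V) :
    multiOpSum σ (Finsupp.single a v) = (multiOp a : DiffOp K n) • σ v := by
  simp [multiOpSum]

/-- The map of `⨁ₐ V` that lowers the exponent of `xᵢ`. -/
noncomputable def lowerExp (K : Type u) [Field K] (V : Type*) [AddCommGroup V] [Module K V]
    (i : Fin n) : ((Fin n →₀ ℕ) →₀ V) →ₗ[K] ((Fin n →₀ ℕ) →₀ V) :=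
  Finsupp.lsum K fun a =>
    if a i = 0 then 0 else Finsupp.lsingle (a - Finsupp.single i 1)

theorem exists_eq_add_single {i : Fin n} {a : Fin n →₀ ℕ} (ha : a i ≠ 0) :
    ∃ b, a = b + Finsupp.single i 1 :=
  ⟨a - Finsupp.single i 1, (tsub_add_cancel_of_le (by simpa using Nat.one_le_iff_ne_zero.2 ha)).symm⟩

theorem lowerExp_single_of_eq_zero {i : Fin n} {a : Fin n →₀ ℕ} (ha : a i = 0) (v : V) :
    lowerExp K V i (Finsupp.single a v) = 0 := by
  simp [lowerExp, ha]

theorem lowerExp_single_add (i : Fin n) (a : Fin n →₀ ℕ) (v : V) :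
    lowerExp K V i (Finsupp.single (a + Finsupp.single i 1) v) = Finsupp.single a v := by
  simp [lowerExp]

theorem lowerExp_apply (i : Fin n) (c : (Fin n →₀ ℕ) →₀ V) (b : Fin n →₀ ℕ) :
    lowerExp K V i c b = c (b + Finsupp.single i 1) := by
  induction c using Finsupp.induction_linear with
  | zero => simp
  | add c d hc hd => rw [map_add, Finsupp.add_apply, Finsupp.add_apply, hc, hd]
  | single a v =>
    by_cases ha : a i = 0
    · rw [lowerExp_single_of_eq_zero ha, Finsupp.single_eq_of_ne, Finsupp.zero_apply]
      rintro rfl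
      simp at ha
    · obtain ⟨a, rfl⟩ := exists_eq_add_single ha
      rw [lowerExp_single_add]
      by_cases h : a = b
      · subst h; simp
      · rw [Finsupp.single_eq_of_ne (Ne.symm h), Finsupp.single_eq_of_ne]
        exact fun h' => h (add_right_cancel h').symm

theorem mulOp_X_smul_multiOpSum {σ : V →ₗ[K] M}
    (hσ : ∀ i v, (mulOp (X i) : DiffOp K n) • σ v = 0) (i : Fin n) (c : (Fin n →₀ ℕ) →₀ V) :
    (mulOp (X i) : DiffOp K n) • multiOpSum (n := n) σ c =
      multiOpSum (n := n) σ (-lowerExp K V i c) := by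
  induction c using Finsupp.induction_linear with
  | zero => simp
  | add c d hc hd => rw [map_add, map_add, smul_add, hc, hd, ← map_add, neg_add]
  | single a v =>
    rw [multiOpSum_single]
    by_cases ha : a i = 0
    · rw [lowerExp_single_of_eq_zero ha, mulOp_X_smul_multiOp_smul_of_eq_zero (hσ i v) ha,
        neg_zero, map_zero]
    · obtain ⟨a, rfl⟩ := exists_eq_add_single ha
      rw [lowerExp_single_add, mulOp_X_smul_multiOp_smul (hσ i v), map_neg, multiOpSum_single]

/-- The image is stable under the generators of `𝒟` by the commutation rules, hence under `𝒟`.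
Existence of `d` is enough, as the lemma is also applied to a product of two modules. -/
theorem exists_smul_multiOpSum_eq {σ : V →ₗ[K] M}
    (hσ : ∀ i v, (mulOp (X i) : DiffOp K n) • σ v = 0) (P : DiffOp K n)
    (c : (Fin n →₀ ℕ) →₀ V) : ∃ d, P • multiOpSum (n := n) σ c = multiOpSum (n := n) σ d := by
  induction P using diffOp_induction generalizing c with
  | hc k => exact ⟨k • c, by rw [algebraMap_smul, map_smul]⟩
  | hX i => exact ⟨_, mulOp_X_smul_multiOpSum hσ i c⟩
  | hd i j =>
    induction c using Finsupp.induction_linear with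
    | zero => exact ⟨0, by simp⟩
    | add c d hc hd =>
      obtain ⟨c', hc⟩ := hc
      obtain ⟨d', hd⟩ := hd
      exact ⟨c' + d', by rw [map_add, map_add, smul_add, hc, hd]⟩
    | single a v =>
      refine ⟨(a i + j).choose j • Finsupp.single (a + Finsupp.single i j) v, ?_⟩
      rw [map_nsmul, multiOpSum_single, multiOpSum_single, ← mul_smul, partialOp_mul_multiOp,
        smul_assoc]
  | hadd P Q hP hQ =>
    obtain ⟨c', hc⟩ := hP c
    obtain ⟨d', hd⟩ := hQ c
    exact ⟨c' + d', by rw [map_add, add_smul, hc, hd]⟩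
  | hmul P Q hP hQ =>
    obtain ⟨c', hc⟩ := hQ c
    obtain ⟨d', hd⟩ := hP c'
    exact ⟨d', by rw [mul_smul, hc, hd]⟩

/-- Applying `xᵢ` to a relation lowers its exponents and again gives a relation. By induction on the
degree of the support the lowered relations are trivial, so only the coefficient at `a = 0` is left,
where `σ` is injective. -/
theorem multiOpSum_injective {σ : V →ₗ[K] M} (hinj : Function.Injective σ)
    (hσ : ∀ i v, (mulOp (X i) : DiffOp K n) • σ v = 0) :
    Function.Injective (multiOpSum (n := n) σ) := by
  have key : ∀ (N : ℕ) (c : (Fin n →₀ ℕ) →₀ V), (∀ a, N ≤ a.degree → c a = 0) →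
      multiOpSum (n := n) σ c = 0 → c = 0 := by
    intro N
    induction N with
    | zero => exact fun c hc _ => Finsupp.ext fun a => hc a (Nat.zero_le _)
    | succ N ih =>
      intro c hc h
      have h1 : ∀ i, lowerExp K V i c = 0 := by
        intro i
        refine ih _ (fun a ha => ?_) ?_
        · rw [lowerExp_apply]
          refine hc _ ?_
          rw [map_add, Finsupp.degree_single]
          omega
        · have h2 := mulOp_X_smul_multiOpSum hσ i c
          rw [h, smul_zero, map_neg] at h2
          exact neg_eq_zero.1 h2.symm
      have h2 : c = Finsupp.single 0 (c 0) := by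
        ext a
        by_cases ha : a = 0
        · subst ha; simp
        · obtain ⟨i, hi⟩ := Finsupp.ne_iff.1 ha
          obtain ⟨b, rfl⟩ := exists_eq_add_single hi
          rw [Finsupp.single_eq_of_ne ha, ← lowerExp_apply (K := K), h1 i, Finsupp.zero_apply]
      rw [h2, multiOpSum_single, multiOp_zero, one_smul] at h
      rw [h2, (map_eq_zero_iff σ hinj).1 h, Finsupp.single_zero]
  rw [injective_iff_map_eq_zero]
  intro c h
  refine key (c.support.sup Finsupp.degree + 1) c (fun a ha => ?_) h
  by_contra hne
  have := Finset.le_sup (f := Finsupp.degree) (Finsupp.mem_support_iff.2 hne)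
  omega

/-- Double induction: on the number `k` of last variables not assumed to kill `z`, and on the
exponent `N` of a power of the first of these that kills `z`. For `k = 0` the element lies in the
socle. -/
theorem multiOpSum_surjective {σ : V →ₗ[K] M} (ht : IsVarTorsion K n M)
    (hσ : ∀ i v, (mulOp (X i) : DiffOp K n) • σ v = 0)
    (hsurj : ∀ z : M, (∀ i, (mulOp (X i) : DiffOp K n) • z = 0) → ∃ v, σ v = z) :
    Function.Surjective (multiOpSum (n := n) σ) := by
  have key : ∀ (k : ℕ) (z : M), (∀ i : Fin n, (i : ℕ) + k < n → (mulOp (X i) : DiffOp K n) • z = 0) →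
      ∃ c, multiOpSum (n := n) σ c = z := by
    intro k
    induction k with
    | zero =>
      intro z hz
      obtain ⟨v, rfl⟩ := hsurj z fun i => hz i (by simp)
      exact ⟨Finsupp.single 0 v, by rw [multiOpSum_single, multiOp_zero, one_smul]⟩
    | succ k ih =>
      intro z hz
      by_cases hk : k < n
      swap
      · exact ih z fun i hi => by omega
      have aux : ∀ (N : ℕ) (z : M), (∀ i : Fin n, (i : ℕ) + (k + 1) < n →
          (mulOp (X i) : DiffOp K n) • z = 0) →
          (mulOp (X (⟨n - 1 - k, by omega⟩ : Fin n)) ^ N : DiffOp K n) • z = 0 →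
          ∃ c, multiOpSum (n := n) σ c = z := by
        set j : Fin n := ⟨n - 1 - k, by omega⟩ with hj
        intro N
        induction N with
        | zero => exact fun z _ h => ⟨0, by simpa using h.symm⟩
        | succ N ihN =>
          intro z hz h
          -- `s` is killed by `x_j` and by all earlier variables, so the outer induction puts it in
          -- the image.
          set s : M := (mulOp (X j) ^ N : DiffOp K n) • z with hs
          have hs0 : (mulOp (X j) : DiffOp K n) • s = 0 := by
            rw [hs, ← mul_smul, ← pow_succ', h]
          have hsi : ∀ i : Fin n, (i : ℕ) + (k + 1) < n → (mulOp (X i) : DiffOp K n) • s = 0 := by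
            intro i hi
            rw [hs, ← mul_smul, ← map_pow, mulOp_comm, mul_smul, hz i hi, smul_zero]
          obtain ⟨c, hc⟩ := ih s fun i hi => by
            by_cases hij : i = j
            · rw [hij, hs0]
            · refine hsi i ?_
              have : (i : ℕ) ≠ n - 1 - k := fun h' => hij (Fin.ext h')
              omega
          obtain ⟨d, hd⟩ := exists_smul_multiOpSum_eq hσ ((-1) ^ N * partialOp j N) c
          -- Since `x_jᴺ ∂_j^[N] s = (-1)ᴺ s`, subtracting `(-1)ᴺ ∂_j^[N] s` from `z` gives an
          -- element killed by `x_jᴺ`. The earlier variables commute with `∂_j^[N]` and still kill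
          -- it.
          obtain ⟨d', hd'⟩ := ihN (z - ((-1) ^ N * partialOp j N : DiffOp K n) • s) (by
              intro i hi
              rw [smul_sub, hz i hi, ← mul_smul, ← mul_assoc,
                ((Commute.neg_one_right (mulOp (X i) : DiffOp K n)).pow_right N).eq, mul_assoc,
                ← multiOp_single, mul_smul, mul_smul, mulOp_X_smul_multiOp_smul_of_eq_zero (hsi i hi)
                  (Finsupp.single_eq_of_ne (fun h' => by rw [h', hj] at hi; simp at hi; omega)),
                smul_zero, sub_zero]) (by
              have h1 := eulerVar_smul_of_mulOp_X_smul hs0 N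
              rw [choose_neg_one, eulerVar, map_pow, mul_smul] at h1
              rw [smul_sub, ← mul_smul, ← mul_assoc,
                ((Commute.neg_one_right (mulOp (X j) ^ N : DiffOp K n)).pow_right N).eq, mul_assoc,
                mul_smul, mul_smul, h1, ← hs]
              rcases Nat.even_or_odd N with h2 | h2 <;> simp [h2.neg_one_pow])
          exact ⟨d' + d, by rw [map_add, hd', ← hd, hc, sub_add_cancel]⟩
      obtain ⟨N, hN⟩ := ht ⟨n - 1 - k, by omega⟩ z
      exact aux N z hz hN
  exact fun z => key n z fun i hi => by omega

/-- Two torsion `𝒟`-modules with isomorphic socles are isomorphic. -/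
theorem nonempty_linearEquiv_of_socle {σ : V →ₗ[K] M} {τ : V →ₗ[K] N}
    (hM : IsVarTorsion K n M) (hN : IsVarTorsion K n N)
    (hσ : Function.Injective σ) (hτ : Function.Injective τ)
    (hσ' : ∀ z : M, (∀ i, (mulOp (X i) : DiffOp K n) • z = 0) ↔ ∃ v, σ v = z)
    (hτ' : ∀ z : N, (∀ i, (mulOp (X i) : DiffOp K n) • z = 0) ↔ ∃ v, τ v = z) :
    Nonempty (M ≃ₗ[DiffOp K n] N) := by
  have h1 : ∀ i v, (mulOp (X i) : DiffOp K n) • σ v = 0 := fun i v => (hσ' _).2 ⟨v, rfl⟩ i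
  have h2 : ∀ i v, (mulOp (X i) : DiffOp K n) • τ v = 0 := fun i v => (hτ' _).2 ⟨v, rfl⟩ i
  let eM := LinearEquiv.ofBijective (multiOpSum (n := n) σ)
    ⟨multiOpSum_injective hσ h1, multiOpSum_surjective hM h1 fun z => (hσ' z).1⟩
  let eN := LinearEquiv.ofBijective (multiOpSum (n := n) τ)
    ⟨multiOpSum_injective hτ h2, multiOpSum_surjective hN h2 fun z => (hτ' z).1⟩
  -- Stability of the image in `M × N` yields a single `d` with `P • eM c = eM d` and `P • eN c = eN
  -- d`; this is the `𝒟`-linearity of `eN ∘ eM⁻¹`, with no formula for `d`.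
  have h3 : ∀ c, multiOpSum (n := n) (σ.prod τ) c = (eM c, eN c) := by
    intro c
    induction c using Finsupp.induction_linear with
    | zero => rw [map_zero, map_zero, map_zero]; rfl
    | add c d hc hd => rw [map_add, map_add, map_add, hc, hd]; rfl
    | single a v =>
      rw [multiOpSum_single]
      exact Prod.ext (multiOpSum_single σ a v).symm (multiOpSum_single τ a v).symm
  refine ⟨{ eM.symm.trans eN with
    map_smul' := fun P z => ?_ }⟩
  obtain ⟨c, rfl⟩ := eM.surjective z
  obtain ⟨d, hd⟩ := exists_smul_multiOpSum_eq (σ := σ.prod τ)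
    (fun i v => Prod.ext (h1 i v) (h2 i v)) P c
  rw [h3, h3] at hd
  have h4 : P • eM c = eM d := congrArg Prod.fst hd
  have h5 : P • eN c = eN d := congrArg Prod.snd hd
  change eN (eM.symm (P • eM c)) = P • eN (eM.symm (eM c))
  rw [h4, eM.symm_apply_apply, eM.symm_apply_apply, h5]

end Structure

/-! ### The inverse polynomials: torsion, with socle spanned by `1 / (x₁ ⋯ xₙ)`. -/

section InversePolynomials

variable (K : Type u) [Field K] (n : ℕ)

/-- The product `x₁ ⋯ xₙ` of the variables. -/
noncomputable abbrev prodX : MvPolynomial (Fin n) K := ∏ i : Fin n, X i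

/-- The ring `R_{x₁ ⋯ xₙ}` of Laurent polynomials, as a `𝒟`-module. -/
abbrev LaurentModule : Type u := Loc (prodX K n) (MvPolynomial (Fin n) K)

/-- The submodule of `R_{x₁ ⋯ xₙ}` spanned by the Laurent monomials that are zero in the module of
inverse polynomials. -/
noncomputable def regularPart :
    Submodule (DiffOp K n) (LaurentModule K n) :=
  ⨆ i : Fin n, LinearMap.range
    (Loc.res (X : Fin n → MvPolynomial (Fin n) K) (MvPolynomial (Fin n) K)
      (Finset.erase_subset i Finset.univ))

/-- The projection of `R_{x₁ ⋯ xₙ}` onto the module of inverse polynomials. -/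
noncomputable def toInversePolynomials :
    LaurentModule K n →ₗ[DiffOp K n]
      (inversePolynomials K n).carrier :=
  (regularPart K n).mkQ

/-- The class of `1 / (x₁ ⋯ xₙ)`. -/
noncomputable def invProdX : (inversePolynomials K n).carrier :=
  toInversePolynomials K n (Loc.mk (1 : MvPolynomial (Fin n) K) 1)

variable {K n}

theorem toInversePolynomials_surjective : Function.Surjective (toInversePolynomials K n) :=
  Submodule.mkQ_surjective _

theorem toInversePolynomials_eq_zero_iff
    {y : LaurentModule K n} :
    toInversePolynomials K n y = 0 ↔ y ∈ regularPart K n :=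
  Submodule.Quotient.mk_eq_zero _

theorem res_mk (i : Fin n) (g : MvPolynomial (Fin n) K) (t : ℕ) :
    Loc.res (X : Fin n → MvPolynomial (Fin n) K) (MvPolynomial (Fin n) K)
      (Finset.erase_subset i Finset.univ) (Loc.mk g t) = Loc.mk (X i ^ t * g) t := by
  rw [Loc.res, Loc.map_mk, prod_sdiff_erase (Finset.mem_univ i), ← map_pow, mulOp_smul]

theorem mk_X_pow_mul_mem (i : Fin n) (g : MvPolynomial (Fin n) K) (t : ℕ) :
    (Loc.mk (X i ^ t * g) t : LaurentModule K n) ∈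
      regularPart K n :=
  Submodule.mem_iSup_of_mem i ⟨Loc.mk g t, res_mk i g t⟩

theorem isVarTorsion_inversePolynomials :
    IsVarTorsion K n (inversePolynomials K n).carrier := by
  intro i z
  obtain ⟨y, rfl⟩ := toInversePolynomials_surjective z
  obtain ⟨g, t, rfl⟩ := Loc.exists_mk y
  refine ⟨t, ?_⟩
  rw [← map_smul, ← map_pow, Loc.smul_mk, toInversePolynomials_eq_zero_iff]
  exact mk_X_pow_mul_mem i g t

theorem mulOp_X_smul_invProdX (i : Fin n) :
    (mulOp (X i) : DiffOp K n) • invProdX K n = 0 := by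
  rw [invProdX, ← map_smul, Loc.smul_mk, toInversePolynomials_eq_zero_iff, mulOp_smul]
  simpa using mk_X_pow_mul_mem i (1 : MvPolynomial (Fin n) K) 1

theorem prod_X_pow_eq_monomial (t : ℕ) : prodX K n ^ t =
    monomial (Finsupp.equivFunOnFinite.symm fun _ => t) 1 := by
  rw [prodX, monomial_eq, Finsupp.prod_fintype _ _ (by simp), C_1, one_mul, ← Finset.prod_pow]
  rfl

/-- Over the denominator `(x₁ ⋯ xₙ)ᵗ`, numerators of regular elements lie in `(x₁ᵗ, …, xₙᵗ)`. Asking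
this for all large `t` lets sums share a denominator and turns non-membership into a test on a
monomial ideal. -/
theorem exists_mem_span_of_mem_regularPart
    {y : LaurentModule K n} (hy : y ∈ regularPart K n) :
    ∃ t₀ : ℕ, ∀ t ≥ t₀, ∃ g ∈ Ideal.span ((fun e => monomial e (1 : K)) ''
      Set.range fun i : Fin n => Finsupp.single i t),
      (mulOp (prodX K n) ^ t : DiffOp K n) • y = oreMk _ _ g := by
  rw [regularPart] at hy
  induction hy using Submodule.iSup_induction' with
  | mem i y hy =>
    obtain ⟨w, rfl⟩ := hy
    obtain ⟨g, t₀, rfl⟩ := Loc.exists_mk w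
    refine ⟨t₀, fun t ht => ?_⟩
    obtain ⟨r, rfl⟩ := Nat.exists_eq_add_of_le' ht
    refine ⟨prodX K n ^ r * (X i ^ t₀ * g), ?_, ?_⟩
    · rw [prodX, ← Finset.mul_prod_erase _ _ (Finset.mem_univ i), mul_pow]
      rw [show (X i ^ r * (∏ x ∈ Finset.univ.erase i, X x) ^ r * (X i ^ t₀ * g) :
        MvPolynomial (Fin n) K) = (∏ x ∈ Finset.univ.erase i, X x) ^ r * g * X i ^ (r + t₀) by ring]
      refine Ideal.mul_mem_left _ _ (Ideal.subset_span ⟨_, ⟨i, rfl⟩, ?_⟩)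
      simp only
      rw [X_pow_eq_monomial]
    · rw [res_mk, pow_add, mul_smul, Loc.pow_smul_mk, ← map_smul, ← map_pow, mulOp_smul]
  | zero => exact ⟨0, fun t _ => ⟨0, zero_mem _, by rw [smul_zero, map_zero]⟩⟩
  | add y z _ _ hy hz =>
    obtain ⟨a, ha⟩ := hy
    obtain ⟨b, hb⟩ := hz
    refine ⟨max a b, fun t ht => ?_⟩
    obtain ⟨g, hg, hg'⟩ := ha t ((le_max_left _ _).trans ht)
    obtain ⟨h, hh, hh'⟩ := hb t ((le_max_right _ _).trans ht)
    exact ⟨g + h, add_mem hg hh, by rw [smul_add, map_add, hg', hh']⟩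

/-- Otherwise `(x₁ ⋯ xₙ)ᵗ` would lie in `(x₁^(t+1), …, xₙ^(t+1))` for some `t`, while all its
exponents are only `t`. The equation descends from the localization to `R` because `R` is a domain.
-/
theorem invProdX_ne_zero : invProdX K n ≠ 0 := by
  rw [invProdX, Ne, toInversePolynomials_eq_zero_iff]
  intro h
  obtain ⟨t, ht⟩ := exists_mem_span_of_mem_regularPart h
  obtain ⟨g, hg, h1⟩ := ht (t + 1) (Nat.le_succ t)
  rw [pow_succ, mul_smul] at h1
  have h2 := Loc.pow_smul_mk (f := prodX K n) (1 : MvPolynomial (Fin n) K) 1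
  rw [pow_one] at h2
  rw [h2, ← map_smul, ← sub_eq_zero, ← map_sub] at h1
  obtain ⟨⟨_, r, rfl⟩, hr⟩ := oreDiv_one_eq_zero h1
  simp only at hr
  rw [← map_pow, ← map_pow, mulOp_smul, mulOp_smul, mul_one] at hr
  have hx : prodX K n ^ r ≠ 0 :=
    pow_ne_zero _ (Finset.prod_ne_zero_iff.2 fun i _ => X_ne_zero i)
  have h3 := (mul_eq_zero.1 hr).resolve_left hx
  rw [sub_eq_zero] at h3
  rw [← h3, prod_X_pow_eq_monomial, mem_ideal_span_monomial_image] at hg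
  obtain ⟨_, ⟨i, rfl⟩, hi⟩ := hg (Finsupp.equivFunOnFinite.symm fun _ => t) (by simp)
  have := hi i
  simp at this

/-- It suffices to treat `xᵐ / (x₁ ⋯ xₙ)ᵗ` with `|m| = n (t - 1)`. If some `mᵢ ≥ t`, it is regular;
otherwise all `mᵢ ≤ t - 1`, the sum forces equality, and the fraction is `1 / (x₁ ⋯ xₙ)`. -/
theorem exists_sub_mem_regularPart {t : ℕ} {g : MvPolynomial (Fin n) K}
    (hg : g ∈ polyDeg K n (-(n : ℤ) + t * n)) :
    ∃ c : K, (Loc.mk g t - algebraMap K (DiffOp K n) c • Loc.mk (1 : MvPolynomial (Fin n) K) 1 :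
      LaurentModule K n) ∈ regularPart K n := by
  have hadd : ∀ g h : MvPolynomial (Fin n) K,
      (Loc.mk (g + h) t : LaurentModule K n) =
        Loc.mk g t + Loc.mk h t := by
    intro g h
    symm
    rw [Loc.eq_mk_iff, smul_add, Loc.pow_smul_mk, Loc.pow_smul_mk, map_add]
  refine polyDeg_induction (fun g => ∃ c : K,
    (Loc.mk g t - algebraMap K (DiffOp K n) c • Loc.mk (1 : MvPolynomial (Fin n) K) 1 :
      LaurentModule K n) ∈ regularPart K n) ?_ ?_ ?_ hg
  · refine ⟨0, ?_⟩
    have h0 : (Loc.mk 0 t : LaurentModule K n) = 0 := by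
      symm
      rw [Loc.eq_mk_iff, smul_zero, map_zero]
    rw [h0, map_zero, zero_smul, sub_zero]
    exact zero_mem _
  · intro m c hm
    by_cases h : ∃ i, t ≤ m i
    · obtain ⟨i, hi⟩ := h
      refine ⟨0, ?_⟩
      have h1 : monomial m c = X i ^ t * monomial (m - Finsupp.single i t) c := by
        rw [X_pow_eq_monomial, monomial_mul, one_mul, add_tsub_cancel_of_le]
        simpa using hi
      rw [map_zero, zero_smul, sub_zero, h1]
      exact mk_X_pow_mul_mem i _ t
    · push Not at h
      have h1 : ∀ i, m i + 1 = t := by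
        have h2 : ∑ i, (m i + 1) = ∑ _i : Fin n, t := by
          rw [Finsupp.degree_eq_sum] at hm
          zify
          rw [Finset.sum_add_distrib]
          push_cast at hm
          rw [hm]
          simp
          ring
        exact fun i => (Finset.sum_eq_sum_iff_of_le fun i _ => h i).1 h2 i (Finset.mem_univ i)
      refine ⟨c, ?_⟩
      have h3 : prodX K n * monomial m c = C c * prodX K n ^ t := by
        have := prod_X_pow_eq_monomial (K := K) (n := n) 1
        rw [pow_one] at this
        rw [prod_X_pow_eq_monomial, this, monomial_mul, C_mul_monomial, one_mul, mul_one]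
        refine congrArg (fun e => monomial e c) (Finsupp.ext fun i => ?_)
        simp [← h1 i, add_comm]
      have h4 : (Loc.mk (monomial m c) t : LaurentModule K n) =
          algebraMap K (DiffOp K n) c • Loc.mk (1 : MvPolynomial (Fin n) K) 1 := by
        -- Multiplication by `(x₁ ⋯ xₙ) ^ (t + 1)` is injective and clears both denominators.
        apply (Loc.pow_bijective (t + 1)).1
        have h5 := Loc.pow_smul_mk (f := prodX K n) (1 : MvPolynomial (Fin n) K) 1
        rw [pow_one] at h5
        have h6 : (mulOp (prodX K n) ^ (t + 1) : DiffOp K n) •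
            (Loc.mk (monomial m c) t : LaurentModule K n) =
              oreMk _ _ (prodX K n * monomial m c) := by
          rw [pow_succ', mul_smul, Loc.pow_smul_mk, ← map_smul (oreMk _ _), mulOp_smul]
        have h7 : (mulOp (prodX K n) ^ (t + 1) : DiffOp K n) • algebraMap K (DiffOp K n) c •
            (Loc.mk (1 : MvPolynomial (Fin n) K) 1 : LaurentModule K n) =
              oreMk _ _ (prodX K n ^ t * (C c * 1)) := by
          rw [pow_succ, mul_smul, ← mulOp.commutes, algebraMap_eq, ← mul_smul (mulOp (prodX K n)),
            mulOp_comm, mul_smul, h5, ← map_smul (oreMk _ _), ← map_pow, ← map_smul (oreMk _ _),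
            mulOp_smul, mulOp_smul]
        simp only
        rw [h6, h7, h3, mul_one, mul_comm]
      rw [h4, sub_self]
      exact zero_mem _
  · rintro g h ⟨c, hc⟩ ⟨d, hd⟩
    refine ⟨c + d, ?_⟩
    rw [hadd, map_add, add_smul, add_sub_add_comm]
    exact add_mem hc hd

theorem exists_eq_smul_invProdX {z : (inversePolynomials K n).carrier}
    (hz : z ∈ (inversePolynomials K n).deg (-(n : ℤ))) :
    ∃ c : K, algebraMap K (DiffOp K n) c • invProdX K n = z := by
  obtain ⟨_, ⟨g, t, hg, rfl⟩, rfl⟩ := hz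
  have hg' : g ∈ polyDeg K n (-(n : ℤ) + t * n) := by simpa using hg
  obtain ⟨c, hc⟩ := exists_sub_mem_regularPart hg'
  refine ⟨c, ?_⟩
  rw [← toInversePolynomials_eq_zero_iff, map_sub, map_smul, sub_eq_zero] at hc
  exact hc.symm

end InversePolynomials

/-! ### Torsion Eulerian modules are sums of copies of `*E(n)`. -/

section Main

variable {K : Type u} [Field K] {n : ℕ}

theorem IsVarTorsion.finsupp {ι M : Type*} [AddCommGroup M] [Module (DiffOp K n) M]
    (hM : IsVarTorsion K n M) : IsVarTorsion K n (ι →₀ M) := by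
  intro i z
  choose N hN using fun a => hM i (z a)
  refine ⟨z.support.sup N, Finsupp.ext fun a => ?_⟩
  rw [Finsupp.smul_apply, Finsupp.zero_apply]
  by_cases ha : a ∈ z.support
  · exact pow_smul_eq_zero_mono (Finset.le_sup ha) (hN a)
  · rw [Finsupp.notMem_support_iff.1 ha, smul_zero]

/-- The socle of a `𝒟`-module as a vector space over `K`. -/
noncomputable def socleSubmodule (K : Type u) [Field K] (n : ℕ) (M : Type*) [AddCommGroup M]
    [Module K M] [Module (DiffOp K n) M] [IsScalarTower K (DiffOp K n) M] : Submodule K M where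
  carrier := {z | ∀ i, (mulOp (X i) : DiffOp K n) • z = 0}
  add_mem' ha hb i := by rw [smul_add, ha i, hb i, add_zero]
  zero_mem' i := smul_zero _
  smul_mem' c z hz i := by
    have := IsScalarTower.to_smulCommClass' (R := K) (A := DiffOp K n) (M := M)
    rw [smul_comm, hz i, smul_zero]

/-- A torsion Eulerian graded `𝒟`-module is a direct sum of copies of `*E(n)`. -/
theorem IsEulerian.isDirectSumOfCopies {M : GradedDModule K n} (hM : IsEulerian M)
    (ht : IsVarTorsion K n M.carrier) :
    IsDirectSumOfCopies M ((gradedInjectiveHull K n).shift n) := by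
  let E := (inversePolynomials K n).carrier
  -- A graded `𝒟`-module carries no separate `K`-structure; it is restricted from `𝒟`.
  let _ : Module K M.carrier := Module.compHom _ (algebraMap K (DiffOp K n))
  let _ : Module K E := Module.compHom _ (algebraMap K (DiffOp K n))
  have hsm : ∀ (c : K) (z : M.carrier), c • z = algebraMap K (DiffOp K n) c • z := fun _ _ => rfl
  have hsE : ∀ (c : K) (z : E), c • z = algebraMap K (DiffOp K n) c • z := fun _ _ => rfl
  have : IsScalarTower K (DiffOp K n) M.carrier :=
    ⟨fun c P z => by rw [hsm, Algebra.smul_def, mul_smul]⟩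
  have : IsScalarTower K (DiffOp K n) E :=
    ⟨fun c P z => by rw [hsE, Algebra.smul_def, mul_smul]⟩
  let S := socleSubmodule K n M.carrier
  let b := Module.Free.chooseBasis K S
  let ι := Module.Free.ChooseBasisIndex K S
  -- A basis of the socle indexes the copies: `σ` and `τ` identify `K^(ι)` with the socles of `M`
  -- and of the direct sum.
  let σ : (ι →₀ K) →ₗ[K] M.carrier := S.subtype ∘ₗ b.repr.symm.toLinearMap
  let τ : (ι →₀ K) →ₗ[K] (ι →₀ E) :=
    Finsupp.mapRange.linearMap (LinearMap.toSpanSingleton K E (invProdX K n))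
  have hτ : ∀ v a, τ v a = v a • (invProdX K n : E) := fun v a => rfl
  obtain ⟨φ⟩ := nonempty_linearEquiv_of_socle (σ := σ) (τ := τ) ht
    isVarTorsion_inversePolynomials.finsupp
    (S.injective_subtype.comp b.repr.symm.injective)
    (fun v w h => Finsupp.ext fun a => by
      have h1 := DFunLike.congr_fun h a
      rw [hτ, hτ] at h1
      exact smul_left_injective K (invProdX_ne_zero (K := K) (n := n)) h1)
    (fun z => ⟨fun hz => ⟨b.repr ⟨z, hz⟩, by simp [σ]⟩, by
      rintro ⟨v, rfl⟩
      exact (b.repr.symm v).2⟩)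
    (fun z => ⟨fun hz => by
      -- Each component of a socle element of the direct sum is a socle element, hence of degree
      -- `-n`, where the inverse polynomials form a line.
      have h1 : ∀ a, ∃ c : K, c • (invProdX K n : E) = z a := fun a =>
        exists_eq_smul_invProdX (isEulerian_inversePolynomials.mem_deg_of_mulOp_X_smul
          fun i => DFunLike.congr_fun (hz i) a)
      choose c hc using h1
      refine ⟨Finsupp.onFinset z.support c fun a ha => ?_, Finsupp.ext fun a => ?_⟩
      · rw [Finsupp.mem_support_iff, ← hc]
        exact smul_ne_zero ha (invProdX_ne_zero (K := K) (n := n))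
      · rw [hτ, Finsupp.onFinset_apply, hc], by
      rintro ⟨v, rfl⟩ i
      refine Finsupp.ext fun a => ?_
      have := IsScalarTower.to_smulCommClass' (R := K) (A := DiffOp K n) (M := E)
      rw [Finsupp.smul_apply, hτ, smul_comm, mulOp_X_smul_invProdX, smul_zero, Finsupp.zero_apply]⟩)
  refine ⟨ι, φ, fun j z => ?_⟩
  -- The shift by `n` undoes the normalization of `*E`, so `*E(n)` has the natural grading of the
  -- inverse polynomials, which is the Eulerian one.
  have hdeg : ∀ y : E, y ∈ ((gradedInjectiveHull K n).shift n).deg j ↔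
      y ∈ (inversePolynomials K n).deg j := by
    intro y
    change y ∈ (inversePolynomials K n).deg (-(n : ℤ) + (n + j)) ↔ _
    rw [neg_add_cancel_left]
  -- Degrees on both sides are eigenvalue conditions for the Euler operators, which the `𝒟`-linear
  -- `φ` respects.
  rw [hM.mem_deg_iff]
  constructor
  · intro h a
    refine (hdeg _).2 ((isEulerian_inversePolynomials.mem_deg_iff _ _).2 fun r => ?_)
    have h1 := congrArg φ (h r)
    rw [map_smul, map_zsmul] at h1
    exact DFunLike.congr_fun h1 a
  · intro h r
    apply φ.injective
    rw [map_smul, map_zsmul]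
    exact Finsupp.ext fun a =>
      (isEulerian_inversePolynomials.mem_deg_iff _ _).1 ((hdeg _).1 (h a)) r

end Main

end GradedD

theorem mainTheorem1 (K : Type u) [Field K] (n : ℕ) (s : ℕ)
    (J : Fin s → Ideal (MvPolynomial (Fin n) K))
    (G : ∀ k, GradedD.HomogeneousGenerators (J k)) (i : Fin s → ℕ)
    (G₀ : GradedD.HomogeneousGenerators (GradedD.irrelevantIdeal K n)) (i₀ : ℕ) :
    GradedD.IsDirectSumOfCopies
        (G₀.localCohomology (GradedD.iteratedLocalCohomology s G i) i₀)
        ((GradedD.gradedInjectiveHull K n).shift n) ∧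
      ∀ z ∈ GradedD.socle (G₀.localCohomology (GradedD.iteratedLocalCohomology s G i) i₀),
        z ∈ (G₀.localCohomology (GradedD.iteratedLocalCohomology s G i) i₀).deg (-(n : ℤ)) := by
  have h := GradedD.isEulerian_localCohomology G₀
    (GradedD.isEulerian_iteratedLocalCohomology s G i) i₀
  exact ⟨h.isDirectSumOfCopies (G₀.isVarTorsion_localCohomology _ _), fun z hz =>
    h.mem_deg_of_mulOp_X_smul fun k => hz _ (Ideal.subset_span ⟨k, rfl⟩)⟩
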